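/- Let $d\ge 1$. Let $\mathscr U$ be the class of even measurable functions $u:\mathbb R^d\to\mathbb R\cup\{+\infty\}$ for which there are $r_0>0$ and decreasing functions $\varphi:(0,r_0]\to[0,\infty)$, $\psi:[r_0,\infty)\to[0,\infty)$ with $\int_0^{r_0}r^{d-1}\varphi(r)\,dr=+\infty$, $\int_{r_0}^\infty r^{d-1}\psi(r)\,dr<\infty$, $u(x)\ge\varphi(|x|)$ for $0<|x|\le r_0$, and $|u(x)|\le\psi(|x|)$ for $|x|\ge r_0$. Let $\Gamma$ be the set of locally finite subsets of $\mathbb R^d$, with the $\sigma$-algebra generated by the counting variables $\gamma\mapsto\#(\gamma\cap\Delta)$, $\Delta$ bounded Borel. A configuration $\gamma\in\Gamma$ is tempered if there is $t$ with $\sum_{r\in\mathbb Z^d,\,|r|_\infty\le l}\#(\gamma\cap Q_r)^2\le t(2l+1)^d$ for all $l\in\mathbb N_0$, where $Q_r=r+[-\tfrac12,\tfrac12)^d$. For $\beta>0$, $\mu\in\mathbb R$, $v\in\mathscr U$, a tempered $(\beta,\mu,v)$-Gibbs measure is a probability measure $\mathbb P$ on $\Gamma$ that is carried by the tempered configurations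 and satisfies, for every bounded Borel set $\Delta\subset\mathbb R^d$ and every measurable $F:\Gamma\to[0,\infty]$, $$\int_\Gamma F\,d\mathbb P=\sum_{N=0}^\infty\frac{e^{\beta\mu N}}{N!}\int_{\Delta^N}\Bigl(\int_{\{\gamma\subset\mathbb R^d\setminus\Delta\}}F(\gamma\cup\{x_1,\dots,x_N\})\,e^{-\beta W_v(\mathbf x_N;\gamma)}\,d\mathbb P(\gamma)\Bigr)e^{-\beta H_v(\mathbf x_N)}\,d\mathbf x_N ,$$ where $\mathbf x_N=(x_1,\dots,x_N)$, $H_v(\mathbf x_N)=\sum_{i<j}v(x_i-x_j)$, and $W_v(\mathbf x_N;\gamma)=\sum_{i}\sum_{y\in\gamma}v(x_i-y)$ if the series converges absolutely and $W_v=+\infty$ otherwise. Let $\mathscr P$ be the set of all translation-invariant probability measures on $\Gamma$ that are tempered $(\beta,\mu,v)$-Gibbs measures for some $\beta>0$, $\mu\in\mathbb R$, $v\in\mathscr U$. A pair correlation function of $\mathbb P$ is a measurable function $\rho^{(2)}:\mathbb R^d\times\mathbb R^d\to[0,\infty)$ with $\rho^{(2)}(x+a,y+a)=\rho^{(2)}(x,y)$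 for all $a,x,y$ and $$\int_\Gamma\sum_{x,y\in\gamma,\;x\ne y}f(x,y)\,d\mathbb P(\gamma)=\int_{\mathbb R^d\times\mathbb R^d}f(x,y)\,\rho^{(2)}(x,y)\,d(x,y)$$ for all measurable $f\ge0$. **Proposition.** Let $u\in\mathscr U$ and $\mathbb P\in\mathscr P$ (the Gibbs measure $\mathbb P$ may belong to a potential $v$ different from $u$), and let $\Lambda_\ell=[-\ell,\ell]^d$. Then $\mathbb P$ has a pair correlation function, and for every pair correlation function $\rho^{(2)}$ of $\mathbb P$ the limit $$E(u,\mathbb P)=\lim_{\ell\to\infty}\frac1{|\Lambda_\ell|}\int_\Gamma\frac12\sum_{x,y\in\gamma\cap\Lambda_\ell,\;x\ne y}u(x-y)\,d\mathbb P(\gamma)$$ exists in $\mathbb R\cup\{+\infty\}$ and $$E(u,\mathbb P)=\frac12\int_{\mathbb R^d}u(x)\,\rho^{(2)}(x,0)\,dx .$$ Here all integrals of functions with values in $\mathbb R\cup\{+\infty\}$ are well defined in $\mathbb R\cup\{+\infty\}$ (the integrands are measurable and their negative parts are integrable), with the convention $(+\infty)\cdot0=0$. -/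

import Mathlib

open MeasureTheory Filter Topology Set
open scoped ENNReal NNReal

noncomputable section

namespace PairGas

/-- The physical space `ℝ^d` with its Euclidean norm and Lebesgue measure. -/
abbrev Space (d : ℕ) : Type := EuclideanSpace ℝ (Fin d)

/-! ### Pair potentials -/

/-- The class `𝒰` of pair potentials `u : ℝ^d → ℝ ∪ {+∞}`: even functions which near the origin
dominate a nonnegative decreasing radial function that is not integrable, and which outside
a ball are dominated in absolute value by a decreasing radial function that is integrable. -/
structure IsPairPotential {d : ℕ} (u : Space d → EReal) : Prop where
  measurable : Measurable u
  ne_bot : ∀ x, u x ≠ ⊥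
  even : ∀ x, u (-x) = u x
  bounds : ∃ r₀ : ℝ, 0 < r₀ ∧
    (∃ φ : ℝ → ℝ, AntitoneOn φ (Ioc 0 r₀) ∧ (∀ r ∈ Ioc 0 r₀, 0 ≤ φ r) ∧
      ∫⁻ r in Ioc 0 r₀, ENNReal.ofReal (r ^ (d - 1) * φ r) = ⊤ ∧
      ∀ x : Space d, 0 < ‖x‖ → ‖x‖ ≤ r₀ → (φ ‖x‖ : EReal) ≤ u x) ∧
    (∃ ψ : ℝ → ℝ, AntitoneOn ψ (Ici r₀) ∧ (∀ r ∈ Ici r₀, 0 ≤ ψ r) ∧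
      ∫⁻ r in Ici r₀, ENNReal.ofReal (r ^ (d - 1) * ψ r) < ⊤ ∧
      ∀ x : Space d, r₀ ≤ ‖x‖ → (u x).abs ≤ ENNReal.ofReal (ψ ‖x‖))

/-! ### Configurations -/

/-- `Γ`: the locally finite subsets of `ℝ^d`. -/
@[ext]
structure Configuration (d : ℕ) where
  carrier : Set (Space d)
  locallyFinite : ∀ Δ : Set (Space d), Bornology.IsBounded Δ → (carrier ∩ Δ).Finite

namespace Configuration

variable {d : ℕ}

/-- The σ-algebra on `Γ` generated by the counting variables `γ ↦ #(γ ∩ Δ)`, `Δ` a bounded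
Borel set. -/
instance instMeasurableSpace : MeasurableSpace (Configuration d) :=
  ⨆ (Δ : Set (Space d)) (_ : MeasurableSet Δ) (_ : Bornology.IsBounded Δ),
    MeasurableSpace.comap (fun γ : Configuration d => (γ.carrier ∩ Δ).ncard) ⊤

/-- `γ ∪ {x₁, …, x_N}`. -/
def addPoints (γ : Configuration d) {N : ℕ} (x : Fin N → Space d) : Configuration d where
  carrier := γ.carrier ∪ range x
  locallyFinite := fun Δ hΔ => by
    rw [union_inter_distrib_right]
    exact (γ.locallyFinite Δ hΔ).union ((finite_range x).subset inter_subset_left)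

/-- `γ + a`. -/
def translate (a : Space d) (γ : Configuration d) : Configuration d where
  carrier := (fun x => x + a) '' γ.carrier
  locallyFinite := fun Δ hΔ => by
    have hb : Bornology.IsBounded ((fun y => y + -a) '' Δ) :=
      (LipschitzWith.id.add (LipschitzWith.const (-a))).isBounded_image hΔ
    refine ((γ.locallyFinite _ hb).image (fun x => x + a)).subset ?_
    rintro _ ⟨⟨x, hx, rfl⟩, hxΔ⟩
    exact ⟨x, ⟨hx, x + a, hxΔ, by simp⟩, rfl⟩

/-- The unit cube `Q(r)` centred at the lattice point `r`: `r i - 1/2 ≤ x i < r i + 1/2`. -/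
def unitCube (r : Fin d → ℤ) : Set (Space d) :=
  {x | ∀ i, x i ∈ Ico ((r i : ℝ) - 1 / 2) ((r i : ℝ) + 1 / 2)}

/-- Tempered configurations in the sense of Ruelle: for some `t`, for every `l`,
`∑_{|r|_∞ ≤ l} #(γ ∩ Q(r))² ≤ t (2l+1)^d`. -/
def IsTempered (γ : Configuration d) : Prop :=
  ∃ t : ℝ, ∀ l : ℕ,
    ∑ r ∈ Fintype.piFinset (fun _ : Fin d => Finset.Icc (-(l : ℤ)) l),
      ((γ.carrier ∩ unitCube r).ncard : ℝ) ^ 2 ≤ t * (2 * l + 1) ^ d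

end Configuration

/-! ### Tempered Gibbs measures -/

variable {d : ℕ}

/-- `H_u(x₁, …, x_N) = ∑_{i < j} u (x_i - x_j)`. -/
def hamiltonian (u : Space d → EReal) {N : ℕ} (x : Fin N → Space d) : EReal :=
  ∑ p : Fin N × Fin N with p.1 < p.2, u (x p.1 - x p.2)

open Classical in
/-- `W_u(x₁, …, x_N; γ) = ∑_i ∑_{y ∈ γ} u (x_i - y)` if the series converges absolutely,
and `+∞` otherwise. -/
def interaction (u : Space d → EReal) {N : ℕ} (x : Fin N → Space d) (γ : Configuration d) :
    EReal :=
  if ∑ i, ∑' y : γ.carrier, (u (x i - y)).abs < ⊤ then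
    ((∑ i, ∑' y : γ.carrier, (u (x i - y)).toReal : ℝ) : EReal)
  else ⊤

/-- The Boltzmann factor `e^{-β h}` with values in `[0, ∞]`, where `e^{-∞} = 0`. -/
def boltzmann (β : ℝ) (h : EReal) : ℝ≥0∞ := EReal.exp (-((β : EReal) * h))

/-- `P` is a tempered `(β, μ, u)`-Gibbs measure: a probability measure on `Γ`, carried by the
tempered configurations, which satisfies the equilibrium equations
`∫ F dP = ∑_N z^N / N! ∫_{Δ^N} (∫_{Γ(Δᶜ)} F (γ ∪ {x₁, …, x_N}) e^{-β W_u(x; γ)} dP(γ)) e^{-β H_u(x)} dx`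
with `z = e^{βμ}`, for all bounded Borel sets `Δ`.  The equations are imposed on nonnegative
measurable `F`, which is the same as imposing them on all `P`-integrable `F`. -/
structure IsTemperedGibbs (β μ : ℝ) (u : Space d → EReal) (P : Measure (Configuration d)) :
    Prop where
  isProbabilityMeasure : IsProbabilityMeasure P
  tempered : ∀ᵐ γ ∂P, γ.IsTempered
  equilibrium : ∀ Δ : Set (Space d), MeasurableSet Δ → Bornology.IsBounded Δ →
    ∀ F : Configuration d → ℝ≥0∞, Measurable F →
      ∫⁻ γ, F γ ∂P =
        ∑' N : ℕ, ENNReal.ofReal (Real.exp (β * μ) ^ N / N.factorial) *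
          ∫⁻ x in {x : Fin N → Space d | ∀ i, x i ∈ Δ},
            (∫⁻ γ in {γ : Configuration d | γ.carrier ⊆ Δᶜ},
              F (γ.addPoints x) * boltzmann β (interaction u x γ) ∂P) *
            boltzmann β (hamiltonian u x)

/-- Invariance of the law `P` under all translations of `ℝ^d`. -/
def IsTranslationInvariant (P : Measure (Configuration d)) : Prop :=
  ∀ a : Space d, P.map (Configuration.translate a) = P

/-- The class `𝒫`: translation invariant tempered Gibbs measures for some inverse temperature
`β > 0`, some chemical potential `μ` and some pair potential `v` in `𝒰`. -/
def IsInvariantGibbs (P : Measure (Configuration d)) : Prop :=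
  IsTranslationInvariant P ∧
    ∃ (β μ : ℝ) (v : Space d → EReal), 0 < β ∧ IsPairPotential v ∧ IsTemperedGibbs β μ v P

/-- `ρ` is a (translation invariant) pair correlation function of `P`: a density of the second
factorial moment measure,
`∫ ∑_{x, y ∈ γ, x ≠ y} f (x, y) dP(γ) = ∫∫ f (x, y) ρ (x, y) dx dy`. -/
structure IsPairCorrelation (P : Measure (Configuration d)) (ρ : Space d → Space d → ℝ≥0) :
    Prop where
  measurable : Measurable (fun p : Space d × Space d => ρ p.1 p.2)
  translation : ∀ a x y, ρ (x + a) (y + a) = ρ x y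
  density : ∀ f : Space d × Space d → ℝ≥0∞, Measurable f →
    ∫⁻ γ, ∑' p : {p : Space d × Space d //
        p.1 ∈ γ.carrier ∧ p.2 ∈ γ.carrier ∧ p.1 ≠ p.2}, f p ∂P =
      ∫⁻ p : Space d × Space d, f p * ρ p.1 p.2

/-! ### Integrals with values in `ℝ ∪ {+∞}` and the specific energy -/

/-- The integral of `f` is well defined in `ℝ ∪ {+∞}`: `f` is measurable and its negative part
has a finite integral. -/
def HasIntegral {Ω : Type*} [MeasurableSpace Ω] (m : Measure Ω) (f : Ω → EReal) : Prop :=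
  AEMeasurable f m ∧ ∫⁻ ω, (-f ω).toENNReal ∂m < ⊤

/-- The Lebesgue integral `∫ f⁺ - ∫ f⁻`; meaningful under `HasIntegral m f`. -/
def integralE {Ω : Type*} [MeasurableSpace Ω] (m : Measure Ω) (f : Ω → EReal) : EReal :=
  ((∫⁻ ω, (f ω).toENNReal ∂m : ℝ≥0∞) : EReal) - ((∫⁻ ω, (-f ω).toENNReal ∂m : ℝ≥0∞) : EReal)

/-- The box `Λ_ℓ = [-ℓ, ℓ]^d`. -/
def box (d : ℕ) (l : ℝ) : Set (Space d) := {x | ∀ i, |x i| ≤ l}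

lemma isBounded_box (d : ℕ) (l : ℝ) : Bornology.IsBounded (box d l) := by
  have h : Bornology.IsBounded (Metric.closedBall (0 : Fin d → ℝ) |l|) :=
    Metric.isBounded_closedBall
  refine ((PiLp.antilipschitzWith_ofLp 2 (fun _ : Fin d => ℝ)).isBounded_preimage h).subset ?_
  intro x hx
  simp only [mem_preimage, mem_closedBall_zero_iff]
  exact (pi_norm_le_iff_of_nonneg (abs_nonneg l)).2 fun i => (hx i).trans (le_abs_self l)

open Classical in
/-- `(1/2) ∑_{x, y ∈ γ ∩ Λ_ℓ, x ≠ y} u (x - y)`. -/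
def boxEnergy (u : Space d → EReal) (l : ℝ) (γ : Configuration d) : EReal :=
  ((1 / 2 : ℝ) : EReal) *
    ∑ p ∈ (γ.locallyFinite (box d l) (isBounded_box d l)).toFinset.offDiag, u (p.1 - p.2)

/-- The mean energy per volume in `Λ_ℓ`. -/
def meanEnergy (u : Space d → EReal) (P : Measure (Configuration d)) (l : ℝ) : EReal :=
  (((volume (box d l)).toReal⁻¹ : ℝ) : EReal) * integralE P (boxEnergy u l)

/-- The limit defining the specific energy `E(u, P)` exists, with value `e ∈ ℝ ∪ {+∞}`; all the
expectations involved are well defined. -/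
def HasSpecificEnergy (u : Space d → EReal) (P : Measure (Configuration d)) (e : EReal) : Prop :=
  e ≠ ⊥ ∧ (∀ l : ℝ, 0 < l → HasIntegral P (boxEnergy u l)) ∧
    Tendsto (meanEnergy u P) atTop (𝓝 e)

end PairGas

end

namespace PairGas

open ProbabilityTheory PairGas.Configuration

variable {d : ℕ}

/-! ### Unit cubes -/

namespace Configuration

/-! For `F ≥ 0`, the substitution `w = x - y` turns the expected sum of `F (x - y)` over pairs in a
box into the volume of the box times `∫ F(w) ρ(w, 0) overlap(w) dw`, where the overlap is the
fraction of the box that stays in the box under the shift by `w`. It is at most 1 and tends to 1, so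
Fatou's lemma and monotonicity give convergence to `∫ F(w) ρ(w, 0) dw`, which may be infinite
(`tendsto_lintegral_mul_overlap`). Applied separately to the positive and negative parts of `u`,
this proves the formula, provided the negative part has a finite integral against `ρ(·, 0)`, so that
`∞ - ∞` never occurs.

That finiteness rests on one estimate, `IsInvariantGibbs.lintegral_sq_cubeCount_ne_top`: the number
`n_0` of points in a unit cube has a finite second moment `m`. Indeed the negative part of `u` is
dominated by a summable function `c` of the cell of `x` when `y` lies in the central cube, and `n_0
n_s ≤ n_0² + n_s²`.

To bound `m`, use the potential `v` of the Gibbs measure. Its non-integrable repulsion makes it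
superstable with an arbitrarily large constant (`IsPairPotential.superstable`, a multiscale count of
pairs), while the interaction with the exterior is at least `-n_0 ∑ c_s n_s`. Insert into the
equilibrium equation of the central cube the resulting lower bound `t` for the energy, chemical
potential included. As `t e^{-t} ≤ 1`, its expectation is at most `∑ 1/N!`. By stationarity `K m ≤
const + (2βC + 1) m`, with `K` as large as desired. Absorbing `m` requires it to be finite
beforehand. So the argument is run on the sets `densityAtMost d t`, which are invariant under
lattice translations, increase with `t` and exhaust the tempered configurations. On them `m ≤ t`,
and the final bound does not depend on `t`.

For the existence of `ρ`, the equilibrium equations make the second factorial moment measure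
absolutely continuous, and translation invariance disintegrates it along the diagonal. The reduced
measure is σ-finite by the second moment bound, and its density `g` gives `ρ(x, y) = g(x - y)`. -/

/-- The index of the unit cube containing `x`. -/
noncomputable def cubeIndex (x : Space d) : Fin d → ℤ := fun i => ⌊x i + 1 / 2⌋

lemma mem_unitCube_iff {x : Space d} {r : Fin d → ℤ} : x ∈ unitCube r ↔ cubeIndex x = r := by
  simp only [unitCube, mem_ofPred_eq, mem_Ico, funext_iff, cubeIndex, Int.floor_eq_iff]
  refine forall_congr' fun i => ?_
  constructor <;> rintro ⟨h1, h2⟩ <;> constructor <;> linarith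

lemma measurable_cubeIndex : Measurable (cubeIndex : Space d → Fin d → ℤ) := by
  unfold cubeIndex
  fun_prop

lemma measurableSet_unitCube (r : Fin d → ℤ) : MeasurableSet (unitCube r) := by
  have : unitCube r = cubeIndex ⁻¹' {r} := by
    ext x; simp [mem_unitCube_iff]
  rw [this]
  exact measurable_cubeIndex (measurableSet_singleton r)

lemma pairwise_disjoint_unitCube :
    Pairwise (Function.onFun Disjoint (unitCube : (Fin d → ℤ) → Set (Space d))) := by
  intro r s hrs
  refine Set.disjoint_left.2 fun x hx hy => hrs ?_
  rw [mem_unitCube_iff] at hx hy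
  exact hx.symm.trans hy

lemma iUnion_unitCube : ⋃ r, unitCube r = (univ : Set (Space d)) := by
  ext x; simp [mem_unitCube_iff]

lemma unitCube_subset_box (r : Fin d → ℤ) :
    unitCube r ⊆ box d (∑ i, |(r i : ℝ)| + 1) := by
  intro x hx i
  have h := hx i
  have h1 : |(r i : ℝ)| ≤ ∑ i, |(r i : ℝ)| :=
    Finset.single_le_sum (f := fun i => |(r i : ℝ)|) (fun _ _ => abs_nonneg _) (Finset.mem_univ i)
  have h2 := abs_le.1 h1
  have h3 := le_abs_self (r i : ℝ)
  have h4 := neg_abs_le (r i : ℝ)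
  rw [abs_le]
  constructor <;> linarith [h.1, h.2]

lemma isBounded_unitCube (r : Fin d → ℤ) : Bornology.IsBounded (unitCube r) :=
  (isBounded_box d _).subset (unitCube_subset_box r)

lemma volume_unitCube (r : Fin d → ℤ) : volume (unitCube r : Set (Space d)) = 1 := by
  have h := (EuclideanSpace.volume_preserving_symm_measurableEquiv_toLp (Fin d)).measure_preimage
    (s := Set.pi univ fun i => Ico ((r i : ℝ) - 1 / 2) ((r i : ℝ) + 1 / 2))
    (MeasurableSet.univ_pi fun i => measurableSet_Ico).nullMeasurableSet
  have h2 : (MeasurableEquiv.toLp 2 (Fin d → ℝ)).symm ⁻¹'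
      (Set.pi univ fun i => Ico ((r i : ℝ) - 1 / 2) ((r i : ℝ) + 1 / 2)) = unitCube r := by
    ext x; simp [unitCube]
  rw [h2, Real.volume_pi_Ico] at h
  rw [h]
  norm_num

lemma measurableSet_box (l : ℝ) : MeasurableSet (box d l) := by
  unfold box
  measurability

lemma volume_box {l : ℝ} (hl : 0 ≤ l) : volume (box d l) = ENNReal.ofReal ((2 * l) ^ d) := by
  have h := (EuclideanSpace.volume_preserving_symm_measurableEquiv_toLp (Fin d)).measure_preimage
    (s := Set.pi univ fun _ => Icc (-l) l)
    (MeasurableSet.univ_pi fun i => measurableSet_Icc).nullMeasurableSet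
  have h2 : (MeasurableEquiv.toLp 2 (Fin d → ℝ)).symm ⁻¹'
      (Set.pi univ fun _ => Icc (-l) l) = box d l := by
    ext x; simp [box, abs_le, Pi.le_def, forall_and]
  rw [h2, volume_pi_pi] at h
  rw [h]
  simp only [Real.volume_Icc, sub_neg_eq_add, Finset.prod_const, Finset.card_univ, Fintype.card_fin]
  rw [← ENNReal.ofReal_pow (by linarith)]
  ring_nf

/-! ### The point measure of a configuration -/

/-- The sum of the Dirac masses at the points of `γ`. -/
noncomputable def pointMeasure (γ : Configuration d) : Measure (Space d) :=
  Measure.sum fun x : γ.carrier => Measure.dirac (x : Space d)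

lemma lintegral_pointMeasure (γ : Configuration d) (f : Space d → ℝ≥0∞) :
    ∫⁻ x, f x ∂γ.pointMeasure = ∑' x : γ.carrier, f x := by
  simp [pointMeasure, lintegral_sum_measure]

lemma pointMeasure_apply (γ : Configuration d) {A : Set (Space d)} (hA : MeasurableSet A)
    (hb : Bornology.IsBounded A) : γ.pointMeasure A = ((γ.carrier ∩ A).ncard : ℝ≥0∞) := by
  have hfin := γ.locallyFinite A hb
  rw [← lintegral_indicator_one hA, lintegral_pointMeasure,
    tsum_subtype γ.carrier (A.indicator (1 : Space d → ℝ≥0∞)), indicator_indicator,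
    ← tsum_subtype (γ.carrier ∩ A) (1 : Space d → ℝ≥0∞)]
  simp only [Pi.one_apply]
  rw [ENNReal.tsum_set_one, ← hfin.cast_ncard_eq]
  simp

lemma measurable_ncard_inter {A : Set (Space d)} (hA : MeasurableSet A)
    (hb : Bornology.IsBounded A) :
    Measurable fun γ : Configuration d => (γ.carrier ∩ A).ncard := by
  refine Measurable.of_comap_le ?_
  exact le_iSup_of_le A (le_iSup_of_le hA (le_iSup_of_le hb le_rfl))

lemma measurable_of_ncard {Ω : Type*} [MeasurableSpace Ω] {T : Ω → Configuration d}
    (h : ∀ A : Set (Space d), MeasurableSet A → Bornology.IsBounded A →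
      Measurable fun ω => ((T ω).carrier ∩ A).ncard) : Measurable T := by
  rw [measurable_iff_comap_le]
  simp only [instMeasurableSpace, MeasurableSpace.comap_iSup, MeasurableSpace.comap_comp]
  refine iSup_le fun A => iSup_le fun hA => iSup_le fun hb => ?_
  exact (h A hA hb).comap_le

lemma measurable_pointMeasure : Measurable (pointMeasure : Configuration d → _) := by
  refine Measure.measurable_of_measurable_coe _ fun A hA => ?_
  -- Only counts in bounded sets generate the σ-algebra, so a general `A` is cut along the cubes.
  have h : ∀ γ : Configuration d, γ.pointMeasure A = ∑' r, γ.pointMeasure (A ∩ unitCube r) := by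
    intro γ
    rw [← measure_iUnion]
    · rw [← inter_iUnion, iUnion_unitCube, inter_univ]
    · exact fun r s hrs => (pairwise_disjoint_unitCube hrs).mono inter_subset_right
        inter_subset_right
    · exact fun r => hA.inter (measurableSet_unitCube r)
  simp_rw [h]
  refine Measurable.tsum fun r => ?_
  have hb : Bornology.IsBounded (A ∩ unitCube r) :=
    (isBounded_unitCube r).subset inter_subset_right
  simp_rw [fun γ : Configuration d => γ.pointMeasure_apply (hA.inter (measurableSet_unitCube r)) hb]
  exact (measurable_from_top (f := fun n : ℕ => (n : ℝ≥0∞))).comp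
    (measurable_ncard_inter (hA.inter (measurableSet_unitCube r)) hb)

/-- The point measures as a kernel. -/
noncomputable def pointKernel (d : ℕ) : Kernel (Configuration d) (Space d) :=
  ⟨pointMeasure, measurable_pointMeasure⟩

@[simp] lemma pointKernel_apply (γ : Configuration d) : pointKernel d γ = γ.pointMeasure := rfl

lemma measurableSet_ncard_eq (r : Fin d → ℤ) (n : ℕ) :
    MeasurableSet {γ : Configuration d | (γ.carrier ∩ unitCube r).ncard = n} :=
  measurable_ncard_inter (measurableSet_unitCube r) (isBounded_unitCube r)
    (measurableSet_singleton n)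

-- The counts in a cube have no bound uniform in `γ`, so each cube is further split according to the
-- exact number of points it contains. Each piece is then a finite kernel.
open Classical in
instance : IsSFiniteKernel (pointKernel d) := by
  have hfin : ∀ i : (Fin d → ℤ) × ℕ, IsFiniteKernel
      (Kernel.piecewise (measurableSet_ncard_eq i.1 i.2)
        ((pointKernel d).restrict (measurableSet_unitCube i.1)) 0) := by
    intro i
    refine ⟨i.2, ENNReal.natCast_lt_top _, fun γ => ?_⟩
    rw [Kernel.piecewise_apply]
    split_ifs with h
    · rw [Kernel.restrict_apply, Measure.restrict_apply_univ, pointKernel_apply,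
        pointMeasure_apply _ (measurableSet_unitCube _) (isBounded_unitCube _)]
      rw [mem_ofPred_eq] at h
      rw [h]
    · simp
  have hsum : pointKernel d = Kernel.sum fun i : (Fin d → ℤ) × ℕ =>
      (Kernel.piecewise (measurableSet_ncard_eq i.1 i.2)
        ((pointKernel d).restrict (measurableSet_unitCube i.1)) 0) := by
    ext γ A hA
    rw [Kernel.sum_apply' _ _ hA, ENNReal.tsum_prod']
    have h1 : ∀ r : Fin d → ℤ, ∑' n : ℕ, (Kernel.piecewise (measurableSet_ncard_eq r n)
        ((pointKernel d).restrict (measurableSet_unitCube r)) 0) γ A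
        = γ.pointMeasure (A ∩ unitCube r) := by
      intro r
      rw [tsum_eq_single (γ.carrier ∩ unitCube r).ncard]
      · rw [Kernel.piecewise_apply, if_pos (by simp), Kernel.restrict_apply' _ _ _ hA,
          pointKernel_apply]
      · intro n hn
        rw [Kernel.piecewise_apply, if_neg (by simpa using hn.symm)]
        simp
    simp_rw [h1]
    rw [← measure_iUnion, ← inter_iUnion, iUnion_unitCube, inter_univ, pointKernel_apply]
    · exact fun r s hrs => (pairwise_disjoint_unitCube hrs).mono inter_subset_right
        inter_subset_right
    · exact fun r => hA.inter (measurableSet_unitCube r)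
  rw [hsum]
  exact Kernel.isSFiniteKernel_sum

/-! ### Sums over pairs of distinct points -/

/-- The sum of `f` over the ordered pairs of distinct points of `γ`. -/
noncomputable def pairSum (f : Space d × Space d → ℝ≥0∞) (γ : Configuration d) : ℝ≥0∞ :=
  ∑' p : {p : Space d × Space d // p.1 ∈ γ.carrier ∧ p.2 ∈ γ.carrier ∧ p.1 ≠ p.2}, f p

lemma measurableSet_offDiag : MeasurableSet {p : Space d × Space d | p.1 ≠ p.2} :=
  (measurableSet_eq_fun measurable_fst measurable_snd).compl

/-- Writing the sum as an iterated integral against the point kernel makes measurability in `γ` and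
translation covariance consequences of the one-point case. -/
lemma pairSum_eq_lintegral (f : Space d × Space d → ℝ≥0∞) (γ : Configuration d) :
    pairSum f γ = ∫⁻ x, ∫⁻ y, {p : Space d × Space d | p.1 ≠ p.2}.indicator f (x, y)
      ∂γ.pointMeasure ∂γ.pointMeasure := by
  have h1 : pairSum f γ = ∑' p : ({p : Space d × Space d |
      p.1 ∈ γ.carrier ∧ p.2 ∈ γ.carrier ∧ p.1 ≠ p.2} : Set _), f p := rfl
  rw [lintegral_pointMeasure]
  simp_rw [lintegral_pointMeasure]
  rw [h1, tsum_subtype, ENNReal.tsum_prod', tsum_subtype γ.carrier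
    fun x => ∑' y : γ.carrier, {p : Space d × Space d | p.1 ≠ p.2}.indicator f (x, y)]
  refine tsum_congr fun x => ?_
  by_cases hx : x ∈ γ.carrier
  · rw [indicator_of_mem hx, tsum_subtype γ.carrier
      fun y => {p : Space d × Space d | p.1 ≠ p.2}.indicator f (x, y)]
    refine tsum_congr fun y => ?_
    by_cases hy : y ∈ γ.carrier <;> simp [indicator, hx, hy]
  · simp [indicator, hx]

lemma measurable_pairSum {f : Space d × Space d → ℝ≥0∞} (hf : Measurable f) :
    Measurable (pairSum f) := by
  simp_rw [funext (pairSum_eq_lintegral f), ← pointKernel_apply]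
  have hg := hf.indicator (measurableSet_offDiag (d := d))
  have h1 : Measurable fun q : Configuration d × Space d =>
      ∫⁻ y, {p : Space d × Space d | p.1 ≠ p.2}.indicator f (q.2, y) ∂(pointKernel d q.1) := by
    have := Measurable.lintegral_kernel_prod_right
      (κ := (pointKernel d).comap (Prod.fst : Configuration d × Space d → _) measurable_fst)
      (f := fun q y => {p : Space d × Space d | p.1 ≠ p.2}.indicator f (q.2, y))
      (hg.comp ((measurable_snd.comp measurable_fst).prodMk measurable_snd))
    simpa using this
  exact Measurable.lintegral_kernel_prod_right (κ := pointKernel d)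
    (f := fun γ x => ∫⁻ y, {p : Space d × Space d | p.1 ≠ p.2}.indicator f (x, y)
      ∂(pointKernel d γ)) h1

/-! ### Translations -/

lemma measurable_translate (a : Space d) : Measurable (translate a) := by
  refine measurable_of_ncard fun A hA hb => ?_
  have h : ∀ γ : Configuration d, ((translate a γ).carrier ∩ A).ncard
      = (γ.carrier ∩ ((fun x => x + a) ⁻¹' A)).ncard := by
    intro γ
    rw [← ncard_image_of_injective (γ.carrier ∩ _) (add_left_injective a),
      image_inter_preimage]
    rfl
  simp_rw [h]
  refine measurable_ncard_inter (hA.preimage (measurable_add_const a)) ?_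
  have := (LipschitzWith.id.add (LipschitzWith.const (-a))).isBounded_image hb
  refine this.subset ?_
  intro x hx
  exact ⟨x + a, hx, by simp⟩

lemma lintegral_pointMeasure_translate (a : Space d) (γ : Configuration d)
    (f : Space d → ℝ≥0∞) :
    ∫⁻ x, f x ∂(translate a γ).pointMeasure = ∫⁻ x, f (x + a) ∂γ.pointMeasure := by
  rw [lintegral_pointMeasure, lintegral_pointMeasure]
  exact tsum_image f (add_left_injective a).injOn

lemma pairSum_translate (a : Space d) (γ : Configuration d) (f : Space d × Space d → ℝ≥0∞) :
    pairSum f (translate a γ) = pairSum (fun p => f (p.1 + a, p.2 + a)) γ := by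
  rw [pairSum_eq_lintegral, pairSum_eq_lintegral, lintegral_pointMeasure_translate]
  refine lintegral_congr fun x => ?_
  rw [lintegral_pointMeasure_translate]
  refine lintegral_congr fun y => ?_
  simp [indicator]

end Configuration

/-! ### Bounds on pair potentials -/

lemma norm_le_of_abs_le {z : Space d} {b : ℝ} (hb : 0 ≤ b) (h : ∀ i, |z i| ≤ b) :
    ‖z‖ ≤ √d * b := by
  rw [EuclideanSpace.norm_eq]
  have h1 : ∑ i, ‖z i‖ ^ 2 ≤ d * b ^ 2 := by
    calc ∑ i, ‖z i‖ ^ 2 ≤ ∑ _i : Fin d, b ^ 2 :=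
          Finset.sum_le_sum fun i _ => by
            rw [Real.norm_eq_abs]; exact pow_le_pow_left₀ (abs_nonneg _) (h i) 2
      _ = d * b ^ 2 := by simp
  calc √(∑ i, ‖z i‖ ^ 2) ≤ √(d * b ^ 2) := Real.sqrt_le_sqrt h1
    _ = √d * b := by rw [Real.sqrt_mul (by positivity), Real.sqrt_sq hb]

/-- A lattice point as a point of the space. -/
noncomputable def latticePoint (s : Fin d → ℤ) : Space d := WithLp.toLp 2 fun i => (s i : ℝ)

@[simp] lemma latticePoint_apply (s : Fin d → ℤ) (i : Fin d) : latticePoint s i = s i := rfl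

/-- Freezing `ψ` at its value at `r₀` on smaller radii yields a bounded antitone function on the
whole line, so that its argument may later be shifted. The lower bound by `-ψ` persists inside the
ball because `u ≥ φ ≥ 0` there. The origin is excluded, since the class does not control `u 0` from
below. -/
lemma IsPairPotential.exists_antitone_bound {u : Space d → EReal} (hu : IsPairPotential u) :
    ∃ r₀ : ℝ, ∃ ψ : ℝ → ℝ, 0 < r₀ ∧ Antitone ψ ∧ (∀ r, 0 ≤ ψ r) ∧ (∀ r, ψ r ≤ ψ 0) ∧
      IntegrableOn (fun r => r ^ (d - 1) * ψ r) (Ioi r₀) ∧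
      (∀ x, x ≠ 0 → ((-ψ ‖x‖ : ℝ) : EReal) ≤ u x) ∧
      ∃ φ : ℝ → ℝ, AntitoneOn φ (Ioc 0 r₀) ∧ (∀ r ∈ Ioc 0 r₀, 0 ≤ φ r) ∧
      ∫⁻ r in Ioc 0 r₀, ENNReal.ofReal (r ^ (d - 1) * φ r) = ⊤ ∧
      ∀ x : Space d, 0 < ‖x‖ → ‖x‖ ≤ r₀ → (φ ‖x‖ : EReal) ≤ u x := by
  obtain ⟨r₀, hr₀, ⟨φ, hφa, hφ0, hφi, hφu⟩, ψ, hψa, hψ0, hψi, hψu⟩ := hu.bounds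
  have hmem : ∀ r, max r₀ r ∈ Ici r₀ := fun r => mem_Ici.2 (le_max_left _ _)
  have hanti : Antitone fun r => ψ (max r₀ r) := fun a b hab =>
    hψa (hmem a) (hmem b) (max_le_max le_rfl hab)
  refine ⟨r₀, fun r => ψ (max r₀ r), hr₀, hanti, fun r => hψ0 _ (hmem r), ?_, ?_, ?_,
    φ, hφa, hφ0, hφi, hφu⟩
  · intro r
    dsimp only
    rw [max_eq_left hr₀.le]
    exact hψa self_mem_Ici (hmem r) (le_max_left _ _)
  · refine ⟨((measurable_id.pow_const _).mul hanti.measurable).aestronglyMeasurable, ?_⟩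
    rw [hasFiniteIntegral_iff_ofReal]
    · refine lt_of_le_of_lt ?_ hψi
      refine le_trans (le_of_eq ?_) (lintegral_mono_set Ioi_subset_Ici_self)
      refine setLIntegral_congr_fun measurableSet_Ioi fun r hr => ?_
      dsimp only
      rw [max_eq_right (le_of_lt hr)]
    · refine (ae_restrict_iff' measurableSet_Ioi).2 (ae_of_all _ fun r hr => ?_)
      exact mul_nonneg (pow_nonneg (hr₀.le.trans (le_of_lt hr)) _) (hψ0 _ (hmem r))
  · intro x hx
    rcases le_total ‖x‖ r₀ with h | h
    · refine le_trans ?_ (hφu x (norm_pos_iff.2 hx) h)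
      rw [EReal.coe_le_coe_iff]
      have := hφ0 _ ⟨norm_pos_iff.2 hx, h⟩
      have := hψ0 _ (hmem ‖x‖)
      linarith
    · have h1 := hψu x h
      dsimp only
      rw [max_eq_right h]
      induction hux : u x using EReal.rec with
      | bot => exact absurd hux (hu.ne_bot x)
      | top => exact le_top
      | coe a =>
        rw [hux, EReal.abs_def] at h1
        rw [EReal.coe_le_coe_iff]
        have h2 := (ENNReal.ofReal_le_ofReal_iff (hψ0 _ h)).1 h1
        exact (abs_le.1 h2).1

/-- In polar coordinates, the shifted profile is bounded up to radius `R = r₀ + b`. Beyond `R` one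
has `y ≤ (R / r₀) (y - b)`, so the weight `y ^ (d - 1)` is comparable to the shifted weight. -/
lemma integrable_comp_norm_sub (hd : 0 < d) {r₀ : ℝ} (hr₀ : 0 < r₀) {ψ : ℝ → ℝ}
    (hψ : Antitone ψ) (hψ0 : ∀ r, 0 ≤ ψ r) (hψ1 : ∀ r, ψ r ≤ ψ 0)
    (hi : IntegrableOn (fun r => r ^ (d - 1) * ψ r) (Ioi r₀)) {b : ℝ} (hb : 0 ≤ b) :
    Integrable fun z : Space d => ψ (‖z‖ - b) := by
  have : Nonempty (Fin d) := ⟨⟨0, hd⟩⟩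
  have : Nontrivial (Space d) := inferInstance
  rw [integrable_fun_norm_addHaar volume (f := fun r => ψ (r - b))]
  simp only [finrank_euclideanSpace, Fintype.card_fin, smul_eq_mul]
  set R := r₀ + b
  set C := (R / r₀) ^ (d - 1)
  have h1 : Integrable ((Ioi r₀).indicator fun r => C * (r ^ (d - 1) * ψ r)) :=
    (integrable_indicator_iff measurableSet_Ioi).2 (hi.const_mul C)
  have h2 := h1.comp_sub_right b
  have h3 : Integrable ((Ioc 0 R).indicator fun _ => R ^ (d - 1) * ψ 0) :=
    (integrable_indicator_iff measurableSet_Ioc).2 (integrableOn_const (by simp) (by finiteness))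
  refine (h3.add h2).integrableOn.mono' ?_ ?_
  · exact ((measurable_id.pow_const _).mul
      (hψ.measurable.comp (measurable_id.sub_const b))).aestronglyMeasurable
  · refine (ae_restrict_iff' measurableSet_Ioi).2 (ae_of_all _ fun y hy => ?_)
    have hy : 0 < y := hy
    have hR : 0 < R := by positivity
    rw [Real.norm_of_nonneg (mul_nonneg (by positivity) (hψ0 _)), Pi.add_apply]
    rcases le_or_gt y R with h | h
    · rw [indicator_of_mem (show y ∈ Ioc 0 R from ⟨hy, h⟩)]
      have h4 : 0 ≤ (Ioi r₀).indicator (fun r => C * (r ^ (d - 1) * ψ r)) (y - b) := by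
        refine indicator_nonneg (fun r hr => ?_) _
        have : 0 < r := hr₀.trans hr
        have := hψ0 r
        positivity
      have h5 : y ^ (d - 1) * ψ (y - b) ≤ R ^ (d - 1) * ψ 0 :=
        mul_le_mul (pow_le_pow_left₀ hy.le h _) (hψ1 _) (hψ0 _) (by positivity)
      linarith
    · have hyb : r₀ < y - b := by simp only [R] at h; linarith
      rw [indicator_of_notMem (fun h' => absurd h'.2 (not_le.2 h)), zero_add,
        indicator_of_mem (show y - b ∈ Ioi r₀ from hyb), ← mul_assoc]
      refine mul_le_mul_of_nonneg_right ?_ (hψ0 _)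
      rw [← mul_pow]
      refine pow_le_pow_left₀ hy.le ?_ _
      rw [div_mul_eq_mul_div, le_div_iff₀ hr₀]
      simp only [R]
      nlinarith

/-- Lower regularity: a pair potential is bounded below by a summable function of the cells. -/
lemma IsPairPotential.exists_lower_bound (hd : 0 < d) {u : Space d → EReal}
    (hu : IsPairPotential u) : ∃ c : (Fin d → ℤ) → ℝ≥0, ∑' s, (c s : ℝ≥0∞) ≠ ⊤ ∧
      ∀ s, ∀ x ∈ unitCube 0, ∀ y ∈ unitCube s, x ≠ y → ((-(c s : ℝ) : ℝ) : EReal) ≤ u (x - y) := by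
  obtain ⟨r₀, ψ, hr₀, hψ, hψ0, hψ1, hi, hlow, -⟩ := hu.exists_antitone_bound
  -- For `x` in the central cube and `y` in the cube of `s`, the vector `x - y` is within `√d` of
  -- `-s`.
  refine ⟨fun s => (ψ (‖latticePoint s‖ - √d)).toNNReal, ?_, ?_⟩
  -- One `√d` comes from the definition of `c`. The other comes from replacing the lattice point `s`
  -- by an arbitrary point of its cube, in order to compare the sum with an integral.
  · have hI := integrable_comp_norm_sub hd hr₀ hψ hψ0 hψ1 hi (b := 2 * √d) (by positivity)
    have hI2 := hI.lintegral_lt_top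
    refine ne_top_of_le_ne_top hI2.ne ?_
    rw [← setLIntegral_univ, ← iUnion_unitCube, lintegral_iUnion (fun s => measurableSet_unitCube s)
      pairwise_disjoint_unitCube]
    refine ENNReal.tsum_le_tsum fun s => ?_
    calc ((ψ (‖latticePoint s‖ - √d)).toNNReal : ℝ≥0∞)
        = ∫⁻ _z in unitCube s, ENNReal.ofReal (ψ (‖latticePoint s‖ - √d)) := by
          rw [setLIntegral_const, volume_unitCube, mul_one]; rfl
      _ ≤ _ := by
          refine setLIntegral_mono' (measurableSet_unitCube s) fun z hz => ?_
          refine ENNReal.ofReal_le_ofReal (hψ ?_)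
          have h1 : ‖z - latticePoint s‖ ≤ √d * 1 := by
            refine norm_le_of_abs_le zero_le_one fun i => ?_
            have := hz i
            rw [PiLp.sub_apply, latticePoint_apply, abs_le]
            constructor <;> linarith [this.1, this.2]
          have h2 := norm_sub_norm_le z (latticePoint s)
          linarith
  · intro s x hx y hy hxy
    refine le_trans ?_ (hlow _ (sub_ne_zero.2 hxy))
    rw [Real.coe_toNNReal _ (hψ0 _), EReal.coe_le_coe_iff, neg_le_neg_iff]
    refine hψ ?_
    have h1 : ‖latticePoint s + (x - y)‖ ≤ √d * 1 := by
      refine norm_le_of_abs_le zero_le_one fun i => ?_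
      have h1 := hx i
      have h2 := hy i
      simp only [Pi.zero_apply, Int.cast_zero] at h1
      rw [PiLp.add_apply, PiLp.sub_apply, latticePoint_apply, abs_le]
      constructor <;> linarith [h1.1, h2.2, h1.2, h2.1]
    have h2 := norm_sub_le (latticePoint s + (x - y)) (x - y)
    rw [add_sub_cancel_right] at h2
    linarith

/-! ### Superstability -/

lemma coe_finset_sum {ι : Type*} (s : Finset ι) (f : ι → ℝ) :
    ((∑ i ∈ s, f i : ℝ) : EReal) = ∑ i ∈ s, (f i : EReal) := by
  classical
  induction s using Finset.induction_on with
  | empty => simp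
  | insert a s ha ih => rw [Finset.sum_insert ha, Finset.sum_insert ha, EReal.coe_add, ih]

/-- The number of ordered pairs sharing a class is the sum of the squared occupation numbers, so
this is Cauchy–Schwarz over the classes. -/
lemma sq_card_le_mul_sum_same {N : ℕ} {T : Type*} [DecidableEq T] (f : Fin N → T) (S : Finset T)
    (hf : ∀ p, f p ∈ S) :
    (N : ℝ) ^ 2 ≤ S.card * ∑ p, ∑ q, if f p = f q then (1 : ℝ) else 0 := by
  have h1 : (N : ℝ) = ∑ t ∈ S, ∑ p, if f p = t then (1 : ℝ) else 0 := by
    rw [Finset.sum_comm]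
    simp [hf]
  have h2 : ∑ p, ∑ q, (if f p = f q then (1 : ℝ) else 0)
      = ∑ t ∈ S, (∑ p, if f p = t then (1 : ℝ) else 0) ^ 2 := by
    simp_rw [sq, Finset.sum_mul_sum]
    symm
    rw [Finset.sum_comm]
    refine Finset.sum_congr rfl fun p _ => ?_
    rw [Finset.sum_comm]
    refine Finset.sum_congr rfl fun q _ => ?_
    simp [hf, eq_comm]
  rw [h2]
  nth_rewrite 1 [h1]
  exact sq_sum_le_card_mul_sum_sq

/-- Dyadic condensation: bounded partial sums would make the series converge. Comparing `φ` on each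
shell with its value at the inner radius would then make the radial integral finite. -/
lemma exists_le_sum_dyadic (hd : 0 < d) {r₀ R : ℝ} (hR : 0 < R) (hRr : R ≤ r₀) {φ : ℝ → ℝ}
    (hφ : AntitoneOn φ (Ioc 0 r₀)) (hφ0 : ∀ r ∈ Ioc 0 r₀, 0 ≤ φ r)
    (hi : ∫⁻ r in Ioc 0 r₀, ENNReal.ofReal (r ^ (d - 1) * φ r) = ⊤) (C : ℝ) :
    ∃ J : ℕ, C ≤ ∑ i ∈ Finset.range (J + 1), φ (R / 2 ^ i) * ((1 / 2) ^ d) ^ i := by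
  by_contra! hcon
  have hRi : ∀ i : ℕ, R / 2 ^ i ∈ Ioc 0 r₀ := fun i =>
    ⟨by positivity, (div_le_self hR.le (one_le_pow₀ one_le_two)).trans hRr⟩
  have hterm : ∀ i : ℕ, 0 ≤ φ (R / 2 ^ i) * ((1 / 2) ^ d) ^ i := fun i =>
    mul_nonneg (hφ0 _ (hRi i)) (by positivity)
  have hsum : Summable fun i : ℕ => φ (R / 2 ^ i) * ((1 / 2) ^ d) ^ i := by
    refine summable_of_sum_range_le (c := C) hterm fun n => ?_
    exact (Finset.sum_le_sum_of_subset_of_nonneg (Finset.range_mono n.le_succ)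
      fun i _ _ => hterm i).trans (hcon n).le
  have hpiece : ∀ i : ℕ, ∫⁻ r in Ioc (R / 2 ^ (i + 1)) (R / 2 ^ i),
      ENNReal.ofReal (r ^ (d - 1) * φ r)
      ≤ ENNReal.ofReal ((2 * R) ^ d * (φ (R / 2 ^ (i + 1)) * ((1 / 2) ^ d) ^ (i + 1))) := by
    intro i
    have hb : ∀ r ∈ Ioc (R / 2 ^ (i + 1)) (R / 2 ^ i), ENNReal.ofReal (r ^ (d - 1) * φ r)
        ≤ ENNReal.ofReal ((R / 2 ^ i) ^ (d - 1) * φ (R / 2 ^ (i + 1))) := by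
      intro r hr
      have hr0 : 0 < r := (hRi (i + 1)).1.trans hr.1
      refine ENNReal.ofReal_le_ofReal (mul_le_mul (pow_le_pow_left₀ hr0.le hr.2 _) ?_ ?_ ?_)
      · exact hφ (hRi _) ⟨hr0, hr.2.trans (hRi i).2⟩ hr.1.le
      · exact hφ0 _ ⟨hr0, hr.2.trans (hRi i).2⟩
      · exact pow_nonneg (hRi i).1.le _
    refine (setLIntegral_mono' measurableSet_Ioc hb).trans ?_
    rw [setLIntegral_const, Real.volume_Ioc, ← ENNReal.ofReal_mul (mul_nonneg
      (pow_nonneg (hRi i).1.le _) (hφ0 _ (hRi _)))]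
    refine ENNReal.ofReal_le_ofReal ?_
    have h1 : R / 2 ^ i - R / 2 ^ (i + 1) ≤ R / 2 ^ i := by linarith [(hRi (i + 1)).1]
    calc (R / 2 ^ i) ^ (d - 1) * φ (R / 2 ^ (i + 1)) * (R / 2 ^ i - R / 2 ^ (i + 1))
        ≤ (R / 2 ^ i) ^ (d - 1) * φ (R / 2 ^ (i + 1)) * (R / 2 ^ i) :=
          mul_le_mul_of_nonneg_left h1 (mul_nonneg (pow_nonneg (hRi i).1.le _) (hφ0 _ (hRi _)))
      _ = (R / 2 ^ i) ^ (d - 1 + 1) * φ (R / 2 ^ (i + 1)) := by ring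
      _ = (2 * R * (1 / 2) ^ (i + 1)) ^ d * φ (R / 2 ^ (i + 1)) := by
          rw [Nat.sub_add_cancel hd]
          congr 2
          rw [one_div, inv_pow, pow_succ]
          field_simp
      _ = _ := by rw [mul_pow, ← pow_mul, ← pow_mul, mul_comm (i + 1) d]; ring
  have hcover : Ioc 0 r₀ ⊆ Ioc R r₀ ∪ ⋃ i : ℕ, Ioc (R / 2 ^ (i + 1)) (R / 2 ^ i) := by
    intro r hr
    rcases lt_or_ge R r with h | h
    · exact Or.inl ⟨h, hr.2⟩
    · refine Or.inr (mem_iUnion.2 ?_)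
      obtain ⟨n, hn1, hn2⟩ := exists_nat_pow_near_of_lt_one (x := r / R) (y := 1 / 2)
        (div_pos hr.1 hR) ((div_le_one hR).2 h) (by norm_num) (by norm_num)
      refine ⟨n, ?_, ?_⟩
      · rw [lt_div_iff₀ hR] at hn1
        rw [div_eq_mul_one_div, mul_comm, ← one_div_pow]; exact hn1
      · rw [div_le_iff₀ hR] at hn2
        rw [div_eq_mul_one_div, mul_comm, ← one_div_pow]; exact hn2
  have htail := (summable_nat_add_iff 1).2 hsum
  have hfirst : ∫⁻ r in Ioc R r₀, ENNReal.ofReal (r ^ (d - 1) * φ r) ≠ ⊤ := by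
    have hb : ∀ r ∈ Ioc R r₀, ENNReal.ofReal (r ^ (d - 1) * φ r)
        ≤ ENNReal.ofReal (r₀ ^ (d - 1) * φ R) := by
      intro r hr
      have hr0 : 0 < r := hR.trans hr.1
      exact ENNReal.ofReal_le_ofReal (mul_le_mul (pow_le_pow_left₀ hr0.le hr.2 _)
        (hφ ⟨hR, hRr⟩ ⟨hr0, hr.2⟩ hr.1.le) (hφ0 _ ⟨hr0, hr.2⟩)
        (pow_nonneg (hr0.le.trans hr.2) _))
    refine ne_top_of_le_ne_top ?_ (setLIntegral_mono' measurableSet_Ioc hb)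
    rw [setLIntegral_const, Real.volume_Ioc]
    exact ENNReal.mul_ne_top ENNReal.ofReal_ne_top ENNReal.ofReal_ne_top
  refine absurd hi (ne_top_of_le_ne_top ?_ ((lintegral_mono_set hcover).trans
    (lintegral_union_le _ _ _)))
  refine ENNReal.add_ne_top.2 ⟨hfirst, ne_top_of_le_ne_top ?_ ((lintegral_iUnion_le _ _).trans
    (ENNReal.tsum_le_tsum hpiece))⟩
  exact (htail.mul_left _).tsum_ofReal_ne_top

/-- Abel summation for the increments of `w`. -/
lemma sum_increments (w : ℕ → ℝ) (Ψ θ : ℝ) (hΨ : 0 ≤ Ψ) (J : ℕ) (a : ℕ → ℝ)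
    (ha0 : a 0 = w 0 + Ψ) (ha : ∀ i, a (i + 1) = w (i + 1) - w i) :
    (1 - θ) * ∑ i ∈ Finset.range (J + 1), w i * θ ^ i + θ ^ (J + 1) * w J
      ≤ ∑ i ∈ Finset.range (J + 1), a i * θ ^ i := by
  induction J with
  | zero => simp [ha0]; linarith
  | succ n ih =>
    rw [Finset.sum_range_succ _ (n + 1), Finset.sum_range_succ _ (n + 1), ha]
    have : θ ^ (n + 1 + 1) = θ ^ (n + 1) * θ := pow_succ _ _
    rw [this]
    linarith [ih]

lemma two_mul_sum_lt {N : ℕ} (l : Fin N → Fin N → ℝ) (hl : ∀ p q, l p q = l q p) :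
    2 * ∑ p : Fin N × Fin N with p.1 < p.2, l p.1 p.2 = ∑ p, ∑ q, l p q - ∑ p, l p p := by
  have h1 : ∑ p : Fin N × Fin N with p.1 < p.2, l p.1 p.2
      = ∑ p, ∑ q, if p < q then l p q else 0 := by
    rw [Finset.sum_filter, Fintype.sum_prod_type]
  have h2 : ∑ p, ∑ q, (if p < q then l p q else 0) = ∑ p, ∑ q, if q < p then l p q else 0 := by
    rw [Finset.sum_comm]
    simp_rw [hl]
  have h3 : ∑ p, l p p = ∑ p, ∑ q, if p = q then l p q else 0 := by simp
  rw [two_mul, h1]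
  nth_rewrite 2 [h2]
  rw [h3, ← Finset.sum_add_distrib, ← Finset.sum_sub_distrib]
  refine Finset.sum_congr rfl fun p _ => ?_
  rw [← Finset.sum_add_distrib, ← Finset.sum_sub_distrib]
  refine Finset.sum_congr rfl fun q _ => ?_
  rcases lt_trichotomy p q with h | h | h
  · simp [h, h.not_gt, h.ne]
  · simp [h]
  · simp [h, h.not_gt, h.ne']

/-- The index of the dyadic cube of side `2 ^ (-j)` containing `x`. -/
noncomputable def dyadicIndex (j : ℕ) (x : Space d) : Fin d → ℤ :=
  fun k => ⌊2 ^ j * (x k + 1 / 2)⌋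

lemma norm_sub_le_of_dyadicIndex_eq {j : ℕ} {x y : Space d}
    (h : dyadicIndex j x = dyadicIndex j y) : ‖x - y‖ ≤ √d / 2 ^ j := by
  rw [div_eq_mul_one_div]
  refine norm_le_of_abs_le (by positivity) fun k => ?_
  have h1 := (Int.abs_sub_lt_one_of_floor_eq_floor (congrFun h k)).le
  rw [← mul_sub, abs_mul, abs_of_pos (by positivity : (0 : ℝ) < 2 ^ j)] at h1
  rw [PiLp.sub_apply, le_div_iff₀ (by positivity), mul_comm]
  rwa [add_sub_add_right_eq_sub] at h1

lemma dyadicIndex_mem {j : ℕ} {x : Space d} (hx : x ∈ unitCube 0) :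
    dyadicIndex j x ∈ Fintype.piFinset fun _ : Fin d => Finset.Ico (0 : ℤ) (2 ^ j) := by
  rw [Fintype.mem_piFinset]
  intro k
  have h := hx k
  simp only [Pi.zero_apply, Int.cast_zero] at h
  have h2 : (0 : ℝ) < 2 ^ j := by positivity
  rw [Finset.mem_Ico, dyadicIndex, Int.floor_nonneg, Int.floor_lt]
  push_cast
  constructor
  · exact mul_nonneg h2.le (by linarith [h.1])
  · nlinarith [h.2]

open Classical in
/-- The multiscale lower bound for the potential between `x` and `y`. -/
noncomputable def profile (Ψ : ℝ) (a : ℕ → ℝ) (m J : ℕ) (x y : Space d) : ℝ :=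
  -Ψ + ∑ i ∈ Finset.range J,
    a i * if dyadicIndex (m + i) x = dyadicIndex (m + i) y then 1 else 0

/-- Superstability: the energy in a unit cube dominates any multiple of the squared number of
points, up to a linear term. -/
lemma IsPairPotential.superstable (hd : 0 < d) {u : Space d → EReal} (hu : IsPairPotential u)
    (K : ℝ) : ∃ B : ℝ, ∀ (N : ℕ) (x : Fin N → Space d), Function.Injective x →
      (∀ p, x p ∈ unitCube 0) →
      (((K * (N : ℝ) ^ 2 - B * N) / 2 : ℝ) : EReal) ≤ hamiltonian u x := by
  obtain ⟨r₀, ψ, hr₀, hψ, hψ0, hψ1, -, hlow, φ, hφ, hφ0, hφi, hφu⟩ := hu.exists_antitone_bound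
  have hD : 0 < √(d : ℝ) := Real.sqrt_pos.2 (by exact_mod_cast hd)
  -- Start at a scale where two points of a common dyadic cube are close enough for the repulsive
  -- bound `φ` to apply.
  obtain ⟨m, hm⟩ : ∃ m : ℕ, √d / 2 ^ m ≤ r₀ := by
    obtain ⟨m, hm⟩ := pow_unbounded_of_one_lt (√d / r₀) (one_lt_two (α := ℝ))
    exact ⟨m, by rw [div_le_iff₀ (by positivity)]; rw [div_lt_iff₀ hr₀] at hm; linarith⟩
  set R := √d / 2 ^ m
  have hR : 0 < R := by positivity
  set w : ℕ → ℝ := fun i => φ (R / 2 ^ i)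
  have hRi : ∀ i : ℕ, R / 2 ^ i ∈ Ioc 0 r₀ := fun i =>
    ⟨by positivity, (div_le_self hR.le (one_le_pow₀ one_le_two)).trans hm⟩
  have hw0 : ∀ i, 0 ≤ w i := fun i => hφ0 _ (hRi i)
  have hwm : ∀ i, w i ≤ w (i + 1) := fun i => hφ (hRi _) (hRi _) (by
    rw [pow_succ]
    exact div_le_div_of_nonneg_left hR.le (by positivity)
      (le_mul_of_one_le_right (by positivity) one_le_two))
  set Ψ := ψ 0
  have hΨ : 0 ≤ Ψ := hψ0 0
  -- The weights are the increments of `w`, with an extra `Ψ` in the first: if two points share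
  -- their cubes at all scales up to `n`, the profile telescopes to exactly `w n`.
  set a : ℕ → ℝ := fun i => Nat.casesOn i (w 0 + Ψ) fun i => w (i + 1) - w i
  have ha0 : a 0 = w 0 + Ψ := rfl
  have ha1 : ∀ i, a (i + 1) = w (i + 1) - w i := fun i => rfl
  have hann : ∀ i, 0 ≤ a i := by
    rintro (_ | i)
    · rw [ha0]; exact add_nonneg (hw0 0) hΨ
    · rw [ha1]; linarith [hwm i]
  set θ : ℝ := (1 / 2) ^ d
  have hθ : θ ≤ 1 / 2 := pow_le_of_le_one (by norm_num) (by norm_num) hd.ne'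
  have hθ0 : 0 < θ := by positivity
  -- The target includes `Ψ` to offset the constant `-Ψ` in the profile. The factor 2 pays for `1 -
  -- θ ≥ 1/2` in the Abel summation, and `θ ^ m` for starting at scale `m`.
  obtain ⟨J, hJ⟩ := exists_le_sum_dyadic hd hR hm hφ hφ0 hφi (2 * (K + Ψ) / θ ^ m)
  have hJ2 : K + Ψ ≤ ∑ i ∈ Finset.range (J + 1), a i * θ ^ (m + i) := by
    have h1 := sum_increments w Ψ θ hΨ J a ha0 ha1
    have h2 : 0 ≤ ∑ i ∈ Finset.range (J + 1), w i * θ ^ i :=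
      Finset.sum_nonneg fun i _ => mul_nonneg (hw0 i) (by positivity)
    have h3 : 0 ≤ θ ^ (J + 1) * w J := mul_nonneg (by positivity) (hw0 J)
    have h4 : (K + Ψ) / θ ^ m ≤ ∑ i ∈ Finset.range (J + 1), a i * θ ^ i := by
      have h5 : 2 * (K + Ψ) / θ ^ m = 2 * ((K + Ψ) / θ ^ m) := by ring
      rw [h5] at hJ
      have h6 : ∑ i ∈ Finset.range (J + 1), w i * θ ^ i ≤
        2 * ((1 - θ) * ∑ i ∈ Finset.range (J + 1), w i * θ ^ i) := by nlinarith
      change 2 * ((K + Ψ) / θ ^ m) ≤ ∑ i ∈ Finset.range (J + 1), w i * θ ^ i at hJ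
      linarith
    rw [div_le_iff₀ (by positivity), Finset.sum_mul] at h4
    refine h4.trans (le_of_eq (Finset.sum_congr rfl fun i _ => ?_))
    rw [pow_add]; ring
  have hprofile_le : ∀ (n : ℕ) (x y : Space d), profile Ψ a m (n + 1) x y ≤ w n := by
    intro n x y
    have h1 : ∑ i ∈ Finset.range (n + 1), a i = w n + Ψ := by
      induction n with
      | zero => simp [ha0]
      | succ n ih => rw [Finset.sum_range_succ, ih, ha1]; ring
    have h2 : ∑ i ∈ Finset.range (n + 1),
        (a i * if dyadicIndex (m + i) x = dyadicIndex (m + i) y then 1 else 0)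
        ≤ ∑ i ∈ Finset.range (n + 1), a i := by
      refine Finset.sum_le_sum fun i _ => ?_
      split_ifs
      · simp
      · simpa using hann i
    unfold profile
    linarith
  have hpair : ∀ (n : ℕ) (x y : Space d), x ≠ y →
      ((profile Ψ a m n x y : ℝ) : EReal) ≤ u (x - y) := by
    intro n x y hxy
    induction n with
    | zero =>
      refine le_trans ?_ (hlow _ (sub_ne_zero.2 hxy))
      rw [EReal.coe_le_coe_iff]
      simpa [profile] using hψ1 _
    | succ n ih =>
      -- If the cubes at the finest scale agree, the distance is at most `R / 2 ^ n` and `u` exceeds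
      -- `w n`, which bounds the whole profile. Otherwise the last term vanishes and the induction
      -- hypothesis applies.
      by_cases hs : dyadicIndex (m + n) x = dyadicIndex (m + n) y
      · have h1 := norm_sub_le_of_dyadicIndex_eq hs
        have h2 : √d / 2 ^ (m + n) = R / 2 ^ n := by rw [pow_add, div_div]
        rw [h2] at h1
        have h3 : 0 < ‖x - y‖ := norm_pos_iff.2 (sub_ne_zero.2 hxy)
        refine le_trans ?_ (hφu _ h3 (h1.trans (hRi n).2))
        rw [EReal.coe_le_coe_iff]
        exact (hprofile_le n x y).trans (hφ ⟨h3, h1.trans (hRi n).2⟩ (hRi n) h1)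
      · refine le_trans (le_of_eq ?_) ih
        simp [profile, Finset.sum_range_succ, hs]
  -- The linear correction comes from the diagonal of the double sum: each diagonal profile is at
  -- most `w J`.
  refine ⟨w J, fun N x hinj hx => ?_⟩
  have h1 : ((∑ p : Fin N × Fin N with p.1 < p.2, profile Ψ a m (J + 1) (x p.1) (x p.2) : ℝ) :
      EReal) ≤ hamiltonian u x := by
    rw [hamiltonian, coe_finset_sum]
    refine Finset.sum_le_sum fun p hp => hpair _ _ _ (hinj.ne ?_)
    exact (Finset.mem_filter.1 hp).2.ne
  refine le_trans ?_ h1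
  rw [EReal.coe_le_coe_iff]
  have h2 := two_mul_sum_lt (fun p q => profile Ψ a m (J + 1) (x p) (x q))
    (fun p q => by simp only [profile, eq_comm])
  have h3 : ∑ p, profile Ψ a m (J + 1) (x p) (x p) ≤ w J * N := by
    refine (Finset.sum_le_sum fun p _ => hprofile_le J (x p) (x p)).trans ?_
    simp [mul_comm]
  have h4 : K * (N : ℝ) ^ 2 ≤ ∑ p, ∑ q, profile Ψ a m (J + 1) (x p) (x q) := by
    classical
    have h5 : ∑ p, ∑ q, profile Ψ a m (J + 1) (x p) (x q) = -Ψ * (N : ℝ) ^ 2 +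
        ∑ i ∈ Finset.range (J + 1), a i * ∑ p, ∑ q,
          if dyadicIndex (m + i) (x p) = dyadicIndex (m + i) (x q) then (1 : ℝ) else 0 := by
      simp only [profile, Finset.sum_add_distrib, Finset.mul_sum]
      congr 1
      · simp; ring
      · simp_rw [Finset.sum_comm (s := Finset.univ) (t := Finset.range (J + 1))]
    have h6 : ∑ i ∈ Finset.range (J + 1), a i * (θ ^ (m + i) * (N : ℝ) ^ 2)
        ≤ ∑ i ∈ Finset.range (J + 1), a i * ∑ p, ∑ q,
          if dyadicIndex (m + i) (x p) = dyadicIndex (m + i) (x q) then (1 : ℝ) else 0 := by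
      refine Finset.sum_le_sum fun i _ => mul_le_mul_of_nonneg_left ?_ (hann i)
      have h7 := sq_card_le_mul_sum_same (fun p => dyadicIndex (m + i) (x p)) _
        fun p => dyadicIndex_mem (hx p)
      have h8 : ((Fintype.piFinset fun _ : Fin d => Finset.Ico (0 : ℤ) (2 ^ (m + i))).card : ℝ)
          = (θ ^ (m + i))⁻¹ := by
        rw [Fintype.card_piFinset_const]
        simp only [Int.card_Ico, sub_zero, θ]
        rw [← pow_mul, mul_comm d, pow_mul, one_div_pow, one_div_pow, one_div, inv_inv]
        norm_cast
      rw [h8, inv_mul_eq_div, le_div_iff₀ (by positivity)] at h7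
      linarith
    have h9 : ∑ i ∈ Finset.range (J + 1), a i * (θ ^ (m + i) * (N : ℝ) ^ 2)
        = (∑ i ∈ Finset.range (J + 1), a i * θ ^ (m + i)) * (N : ℝ) ^ 2 := by
      rw [Finset.sum_mul]
      exact Finset.sum_congr rfl fun i _ => by ring
    rw [h5]
    have h10 := mul_le_mul_of_nonneg_right hJ2 (sq_nonneg (N : ℝ))
    linarith
  linarith

/-! ### Cube counts -/

namespace Configuration

/-- The number of points of `γ` in the unit cube with index `r`. -/
noncomputable def cubeCount (r : Fin d → ℤ) (γ : Configuration d) : ℝ≥0∞ :=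
  γ.pointMeasure (unitCube r)

lemma cubeCount_eq_ncard (r : Fin d → ℤ) (γ : Configuration d) :
    cubeCount r γ = ((γ.carrier ∩ unitCube r).ncard : ℝ≥0∞) :=
  pointMeasure_apply γ (measurableSet_unitCube r) (isBounded_unitCube r)

lemma measurable_cubeCount (r : Fin d → ℤ) : Measurable (cubeCount r) :=
  (Measure.measurable_coe (measurableSet_unitCube r)).comp measurable_pointMeasure

lemma cubeIndex_add_latticePoint (x : Space d) (b : Fin d → ℤ) :
    cubeIndex (x + latticePoint b) = cubeIndex x + b := by
  funext i
  simp only [cubeIndex, PiLp.add_apply, latticePoint_apply, Pi.add_apply]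
  rw [add_right_comm, Int.floor_add_intCast]

lemma cubeCount_translate (r b : Fin d → ℤ) (γ : Configuration d) :
    cubeCount r (translate (latticePoint b) γ) = cubeCount (r - b) γ := by
  unfold cubeCount
  rw [← lintegral_indicator_one (measurableSet_unitCube r),
    ← lintegral_indicator_one (measurableSet_unitCube (r - b)), lintegral_pointMeasure_translate]
  refine lintegral_congr fun x => ?_
  simp only [indicator, mem_unitCube_iff, cubeIndex_add_latticePoint, eq_sub_iff_add_eq,
    Pi.one_apply]

lemma tsum_mul_cubeCount (c : (Fin d → ℤ) → ℝ≥0∞) (γ : Configuration d) :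
    ∑' s, c s * cubeCount s γ = ∑' y : γ.carrier, c (cubeIndex (y : Space d)) := by
  rw [← lintegral_pointMeasure γ fun y => c (cubeIndex y)]
  have h : ∀ y : Space d, c (cubeIndex y) = ∑' s, c s * (unitCube s).indicator 1 y := by
    intro y
    rw [tsum_eq_single (cubeIndex y)]
    · simp [indicator, mem_unitCube_iff]
    · intro s hs
      simp [indicator, mem_unitCube_iff, hs.symm]
  simp_rw [h]
  rw [lintegral_tsum fun s =>
    ((measurable_one.indicator (measurableSet_unitCube s)).const_mul _).aemeasurable]
  refine tsum_congr fun s => ?_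
  rw [lintegral_const_mul _ (measurable_one.indicator (measurableSet_unitCube s)),
    lintegral_indicator_one (measurableSet_unitCube s)]
  rfl

lemma cubeCount_le_addPoints (r : Fin d → ℤ) (γ : Configuration d) {N : ℕ}
    (x : Fin N → Space d) : cubeCount r γ ≤ cubeCount r (γ.addPoints x) := by
  rw [cubeCount_eq_ncard, cubeCount_eq_ncard]
  exact_mod_cast ncard_le_ncard (inter_subset_inter_left _ subset_union_left)
    ((γ.addPoints x).locallyFinite _ (isBounded_unitCube r))

lemma cubeCount_addPoints {γ : Configuration d} {r : Fin d → ℤ}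
    (hγ : γ.carrier ⊆ (unitCube r)ᶜ) {N : ℕ} {x : Fin N → Space d} (hx : Function.Injective x)
    (hxr : ∀ i, x i ∈ unitCube r) : cubeCount r (γ.addPoints x) = N := by
  rw [cubeCount_eq_ncard]
  have h : (γ.addPoints x).carrier ∩ unitCube r = range x := by
    ext y
    constructor
    · rintro ⟨hy | hy, hyr⟩
      · exact absurd hyr (hγ hy)
      · exact hy
    · rintro ⟨i, rfl⟩
      exact ⟨Or.inr ⟨i, rfl⟩, hxr i⟩
  rw [h, ← image_univ, ncard_image_of_injective _ hx, ncard_univ, Nat.card_eq_fintype_card,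
    Fintype.card_fin]

lemma measurableSet_subset_compl {A : Set (Space d)} (hA : MeasurableSet A)
    (hb : Bornology.IsBounded A) :
    MeasurableSet {γ : Configuration d | γ.carrier ⊆ Aᶜ} := by
  have h : {γ : Configuration d | γ.carrier ⊆ Aᶜ} =
      {γ : Configuration d | (γ.carrier ∩ A).ncard = 0} := by
    ext γ
    simp only [mem_ofPred_eq]
    rw [ncard_eq_zero (γ.locallyFinite A hb), ← disjoint_iff_inter_eq_empty,
      subset_compl_iff_disjoint_right]
  rw [h]
  exact measurable_ncard_inter hA hb (measurableSet_singleton 0)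

end Configuration

/-! ### Consequences of the equilibrium equations -/

/-- The projection to two distinct coordinates is a surjective linear map, so it sends Lebesgue
measure to a multiple of Lebesgue measure, and preimages of null sets are null. -/
lemma ae_pair_notMem {A : Set (Space d × Space d)} (hA : volume A = 0) (N : ℕ) :
    ∀ᵐ x : Fin N → Space d, ∀ i j, i ≠ j → (x i, x j) ∉ A := by
  simp only [ae_all_iff]
  intro i j hij
  by_cases hij' : i = j
  · exact absurd hij' hij
  let L : (Fin N → Space d) →ₗ[ℝ] Space d × Space d :=
    (LinearMap.proj i).prod (LinearMap.proj j)
  have hL : Function.Surjective L := by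
    rintro ⟨a, b⟩
    refine ⟨fun k => if k = i then a else b, ?_⟩
    simp [L, Ne.symm hij]
  have : (volume : Measure (Fin N → Space d)).IsAddHaarMeasure := by
    rw [volume_pi]; infer_instance
  have : (volume : Measure (Space d × Space d)).IsAddHaarMeasure := by
    rw [Measure.volume_eq_prod]; infer_instance
  obtain ⟨c, -, hc⟩ := L.exists_map_addHaar_eq_smul_addHaar volume volume hL
  have hm : Measurable L := (measurable_pi_apply i).prodMk (measurable_pi_apply j)
  have h1 : (volume.map L) A = 0 := by rw [hc, Measure.smul_apply, hA, smul_zero]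
  have h2 : volume (L ⁻¹' A) = 0 :=
    le_antisymm ((Measure.le_map_apply hm.aemeasurable A).trans h1.le) zero_le
  exact measure_eq_zero_iff_ae_notMem.1 h2

lemma volume_diagonal (hd : 0 < d) : volume {p : Space d × Space d | p.1 = p.2} = 0 := by
  have : Nonempty (Fin d) := ⟨⟨0, hd⟩⟩
  have : Nontrivial (Space d) := inferInstance
  rw [Measure.volume_eq_prod,
    Measure.measure_prod_null (measurableSet_eq_fun measurable_fst measurable_snd)]
  refine ae_of_all _ fun x => ?_
  have : Prod.mk x ⁻¹' {p : Space d × Space d | p.1 = p.2} = {x} := by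
    ext y; simp [eq_comm]
  simp only [this, Pi.zero_apply]
  simp

/-- With unit volume and a probability measure, a pointwise bound by 1 on the weighted integrand
leaves only `1 / N!` in the `N`-th term. Coinciding points form a null set, so injective tuples
suffice. Constants are only moved inside integrals, an inequality that needs no measurability of the
Boltzmann factors. -/
lemma IsTemperedGibbs.lintegral_le (hd : 0 < d) {β μ : ℝ} {v : Space d → EReal}
    {P : Measure (Configuration d)} (hP : IsTemperedGibbs β μ v P) {Δ : Set (Space d)}
    (hΔ : MeasurableSet Δ) (hb : Bornology.IsBounded Δ) (hvol : volume Δ = 1)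
    {F : Configuration d → ℝ≥0∞} (hF : Measurable F)
    (hle : ∀ (N : ℕ) (x : Fin N → Space d), Function.Injective x → (∀ i, x i ∈ Δ) →
      ∀ γ : Configuration d, γ.carrier ⊆ Δᶜ →
        ENNReal.ofReal (Real.exp (β * μ) ^ N) * (F (γ.addPoints x) *
          boltzmann β (interaction v x γ) * boltzmann β (hamiltonian v x)) ≤ 1) :
    ∫⁻ γ, F γ ∂P ≤ ∑' N : ℕ, ENNReal.ofReal (1 / N.factorial) := by
  have := hP.isProbabilityMeasure
  rw [hP.equilibrium Δ hΔ hb F hF]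
  refine ENNReal.tsum_le_tsum fun N => ?_
  have hz : 0 ≤ Real.exp (β * μ) ^ N := by positivity
  rw [div_eq_mul_one_div, ENNReal.ofReal_mul hz, mul_comm (ENNReal.ofReal (_ ^ N)), mul_assoc]
  refine mul_le_of_le_one_right zero_le ?_
  refine (lintegral_const_mul_le _ _).trans ?_
  have hset : {x : Fin N → Space d | ∀ i, x i ∈ Δ} = Set.pi univ fun _ => Δ := by
    ext x; simp
  have hS : MeasurableSet {x : Fin N → Space d | ∀ i, x i ∈ Δ} := by
    rw [hset]; exact MeasurableSet.univ_pi fun _ => hΔ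
  calc _ ≤ ∫⁻ _x in {x : Fin N → Space d | ∀ i, x i ∈ Δ}, 1 := by
        refine lintegral_mono_ae ?_
        filter_upwards [ae_restrict_mem hS, ae_restrict_of_ae (ae_pair_notMem (volume_diagonal hd) N)]
          with x hx hinj
        have hinj' : Function.Injective x := fun i j hij => by
          by_contra hne
          exact hinj i j hne hij
        refine (mul_le_mul_right (lintegral_mul_const_le _ _) _).trans
          ((lintegral_const_mul_le _ _).trans ?_)
        refine (setLIntegral_mono' (measurableSet_subset_compl hΔ hb)
          fun γ hγ => hle N x hinj' hx γ hγ).trans ?_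
        rw [lintegral_one, Measure.restrict_apply_univ]
        exact prob_le_one
    _ = 1 := by
        rw [lintegral_one, Measure.restrict_apply_univ, hset, volume_pi_pi]
        simp [hvol]

lemma interaction_lower_bound {v : Space d → EReal} (hv : ∀ x, v x ≠ ⊥)
    {c : (Fin d → ℤ) → ℝ≥0}
    (hc : ∀ s, ∀ x ∈ unitCube 0, ∀ y ∈ unitCube s, x ≠ y →
      ((-(c s : ℝ) : ℝ) : EReal) ≤ v (x - y))
    {N : ℕ} {x : Fin N → Space d} (hx : ∀ i, x i ∈ unitCube 0) {γ : Configuration d}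
    (hγ : γ.carrier ⊆ (unitCube 0)ᶜ) (hS : ∑' s, (c s : ℝ≥0∞) * cubeCount s γ ≠ ⊤) :
    ((-(N * (∑' s, (c s : ℝ≥0∞) * cubeCount s γ).toReal) : ℝ) : EReal) ≤ interaction v x γ := by
  unfold interaction
  split_ifs
  · rw [EReal.coe_le_coe_iff]
    rw [tsum_mul_cubeCount (fun s => (c s : ℝ≥0∞))] at hS ⊢
    have hsum : Summable fun y : γ.carrier => (c (cubeIndex (y : Space d)) : ℝ) :=
      NNReal.summable_coe.2 (ENNReal.tsum_coe_ne_top_iff_summable.1 hS)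
    have hreal : (∑' y : γ.carrier, (c (cubeIndex (y : Space d)) : ℝ≥0∞)).toReal
        = ∑' y : γ.carrier, (c (cubeIndex (y : Space d)) : ℝ) := by
      rw [ENNReal.tsum_toReal_eq fun _ => ENNReal.coe_ne_top]
      rfl
    rw [hreal]
    have hnn : 0 ≤ ∑' y : γ.carrier, (c (cubeIndex (y : Space d)) : ℝ) :=
      tsum_nonneg fun _ => NNReal.coe_nonneg _
    have hi : ∀ i, -∑' y : γ.carrier, (c (cubeIndex (y : Space d)) : ℝ)
        ≤ ∑' y : γ.carrier, (v (x i - y)).toReal := by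
      intro i
      by_cases hs : Summable fun y : γ.carrier => (v (x i - y)).toReal
      · rw [← tsum_neg]
        refine hsum.neg.tsum_le_tsum (fun y => ?_) hs
        have hne : x i ≠ y := fun h => hγ y.2 (h ▸ hx i)
        have h1 := hc _ (x i) (hx i) y (mem_unitCube_iff.2 rfl) hne
        induction hvy : v (x i - y) using EReal.rec with
        | bot => exact absurd hvy (hv _)
        | top => simp
        | coe a =>
          rw [hvy, EReal.coe_le_coe_iff] at h1
          simpa using h1
      -- A non-summable series has the default value 0, which still lies above the nonpositive
      -- bound.
      · rw [tsum_eq_zero_of_not_summable hs]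
        linarith
    calc -(N * ∑' y : γ.carrier, (c (cubeIndex (y : Space d)) : ℝ))
        = ∑ _i : Fin N, -∑' y : γ.carrier, (c (cubeIndex (y : Space d)) : ℝ) := by simp
      _ ≤ _ := Finset.sum_le_sum fun i _ => hi i
  · exact le_top

lemma boltzmann_top {β : ℝ} (hβ : 0 < β) : boltzmann β ⊤ = 0 := by
  simp [boltzmann, EReal.coe_mul_top_of_pos hβ]

lemma boltzmann_coe (β h : ℝ) : boltzmann β h = ENNReal.ofReal (Real.exp (-(β * h))) := by
  rw [boltzmann, ← EReal.coe_mul, ← EReal.coe_neg, EReal.exp_coe]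

/-- A lower bound for the energy of the points in the central cube, in terms of cube counts. -/
noncomputable def cubeEnergyBound (β K B : ℝ) (c : (Fin d → ℤ) → ℝ≥0) (γ : Configuration d) :
    ℝ≥0∞ :=
  ENNReal.ofReal K * cubeCount 0 γ ^ 2 - (ENNReal.ofReal β * (cubeCount 0 γ *
    ∑' s, (c s : ℝ≥0∞) * cubeCount s γ) + ENNReal.ofReal B * cubeCount 0 γ)

lemma measurable_cubeEnergyBound (β K B : ℝ) (c : (Fin d → ℤ) → ℝ≥0) :
    Measurable (cubeEnergyBound β K B c) := by
  have h : Measurable fun γ : Configuration d => ∑' s, (c s : ℝ≥0∞) * cubeCount s γ :=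
    Measurable.tsum fun s => (measurable_cubeCount s).const_mul _
  exact (((measurable_cubeCount 0).pow_const 2).const_mul _).sub
    ((((measurable_cubeCount 0).mul h).const_mul _).add ((measurable_cubeCount 0).const_mul _))

/-- The functional is at most the exponent `β (w + h) - βμN` of the Gibbs weight, so the claim
reduces to `t ≤ e^t`. Superstability is assumed with constant `2K / β` so that multiplying by `β`
and halving leaves `K N²`. -/
lemma cubeEnergyBound_mul_boltzmann_le {v : Space d → EReal} (hv : ∀ x, v x ≠ ⊥) {β μ K B B' : ℝ}
    (hβ : 0 < β) {c : (Fin d → ℤ) → ℝ≥0}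
    (hc : ∀ s, ∀ x ∈ unitCube 0, ∀ y ∈ unitCube s, x ≠ y →
      ((-(c s : ℝ) : ℝ) : EReal) ≤ v (x - y))
    (hB : ∀ (N : ℕ) (x : Fin N → Space d), Function.Injective x →
      (∀ p, x p ∈ unitCube 0) →
      (((2 * K / β * (N : ℝ) ^ 2 - B * N) / 2 : ℝ) : EReal) ≤ hamiltonian v x)
    (hK : 0 ≤ K) (hB0 : 0 ≤ B') (hB' : β * B / 2 + β * μ ≤ B') {N : ℕ} {x : Fin N → Space d} (hinj : Function.Injective x)
    (hx : ∀ i, x i ∈ unitCube 0) {γ : Configuration d} (hγ : γ.carrier ⊆ (unitCube 0)ᶜ) :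
    ENNReal.ofReal (Real.exp (β * μ) ^ N) * (cubeEnergyBound β K B' c (γ.addPoints x) *
      boltzmann β (interaction v x γ) * boltzmann β (hamiltonian v x)) ≤ 1 := by
  set S := ∑' s, (c s : ℝ≥0∞) * cubeCount s γ with hSdef
  -- Adding points can only increase the subtracted cell sum, so it may be replaced by that of the
  -- exterior configuration.
  have hle : cubeEnergyBound β K B' c (γ.addPoints x) ≤ ENNReal.ofReal K * (N : ℝ≥0∞) ^ 2 -
      (ENNReal.ofReal β * (N * S) + ENNReal.ofReal B' * N) := by
    unfold cubeEnergyBound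
    rw [cubeCount_addPoints hγ hinj hx]
    refine tsub_le_tsub_left ?_ _
    gcongr
    refine ENNReal.tsum_le_tsum fun s => mul_le_mul_right ?_ _
    exact cubeCount_le_addPoints _ _ _
  refine (mul_le_mul_right (mul_le_mul_left (mul_le_mul_left hle _) _) _).trans ?_
  rcases Nat.eq_zero_or_pos N with rfl | hN
  · simp
  -- An infinite cell sum makes the truncated difference vanish. This needs `N > 0`, since `0 * ⊤ =
  -- 0`.
  by_cases hS : S = ⊤
  · have h1 : ENNReal.ofReal β * ((N : ℝ≥0∞) * S) = ⊤ := by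
      rw [hS, ENNReal.mul_top (by exact_mod_cast hN.ne'), ENNReal.mul_top (by simpa using hβ)]
    simp [h1]
  have hW := interaction_lower_bound hv hc hx hγ hS
  have hH := hB N x hinj hx
  rw [← hSdef] at hW
  induction hWx : interaction v x γ using EReal.rec with
  | bot => rw [hWx] at hW; exact absurd (le_bot_iff.1 hW) (EReal.coe_ne_bot _)
  | top => simp [boltzmann_top hβ]
  | coe w =>
  induction hHx : hamiltonian v x using EReal.rec with
  | bot => rw [hHx] at hH; exact absurd (le_bot_iff.1 hH) (EReal.coe_ne_bot _)
  | top => simp [boltzmann_top hβ]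
  | coe h =>
  rw [hWx, EReal.coe_le_coe_iff] at hW
  rw [hHx, EReal.coe_le_coe_iff] at hH
  have hNr : (N : ℝ≥0∞) = ENNReal.ofReal N := by simp
  set t : ℝ := K * (N : ℝ) ^ 2 - (β * (N * S.toReal) + B' * N)
  have ht : ENNReal.ofReal K * (N : ℝ≥0∞) ^ 2 -
      (ENNReal.ofReal β * (N * S) + ENNReal.ofReal B' * N) = ENNReal.ofReal t := by
    rw [← ENNReal.ofReal_toReal hS, hNr, ← ENNReal.ofReal_pow (by positivity),
      ← ENNReal.ofReal_mul hK, ← ENNReal.ofReal_mul (by positivity), ← ENNReal.ofReal_mul hβ.le,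
      ← ENNReal.ofReal_mul hB0, ← ENNReal.ofReal_add (by positivity) (by positivity),
      ← ENNReal.ofReal_sub _ (by positivity)]
  rw [ht, boltzmann_coe, boltzmann_coe, ← ENNReal.ofReal_mul' (Real.exp_pos _).le,
    ← ENNReal.ofReal_mul' (Real.exp_pos _).le, ← ENNReal.ofReal_mul (by positivity),
    ENNReal.ofReal_le_one, ← Real.exp_nat_mul]
  have hkey : t ≤ β * (w + h) - β * μ * N := by
    have h1 : β * h ≥ K * (N : ℝ) ^ 2 - β * B / 2 * N := by
      have := mul_le_mul_of_nonneg_left hH hβ.le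
      have h2 : β * ((2 * K / β * (N : ℝ) ^ 2 - B * N) / 2) = K * (N : ℝ) ^ 2 - β * B / 2 * N := by
        field_simp
      linarith
    have h2 := mul_le_mul_of_nonneg_left hW hβ.le
    have h3 := mul_le_mul_of_nonneg_right hB' (Nat.cast_nonneg (α := ℝ) N)
    simp only [t]
    linarith
  have hexp := (hkey.trans (by linarith : _ ≤ (β * (w + h) - β * μ * N) + 1)).trans
    (Real.add_one_le_exp _)
  calc Real.exp (N * (β * μ)) * (t * Real.exp (-(β * w)) * Real.exp (-(β * h)))
      = t * Real.exp (-(β * (w + h) - β * μ * N)) := by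
        rw [show -(β * (w + h) - β * μ * N) = N * (β * μ) + -(β * w) + -(β * h) by ring,
          Real.exp_add, Real.exp_add]
        ring
    _ ≤ Real.exp (β * (w + h) - β * μ * N) * Real.exp (-(β * (w + h) - β * μ * N)) :=
        mul_le_mul_of_nonneg_right hexp (Real.exp_pos _).le
    _ = 1 := by rw [← Real.exp_add, add_neg_cancel, Real.exp_zero]

/-! ### The second moment of the cube counts -/

/-- The lattice points `r` with `|r|_∞ ≤ l`. -/
noncomputable abbrev latticeBox (d : ℕ) (l : ℕ) : Finset (Fin d → ℤ) :=
  Fintype.piFinset fun _ : Fin d => Finset.Icc (-(l : ℤ)) l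

lemma card_latticeBox (d l : ℕ) : (latticeBox d l).card = (2 * l + 1) ^ d := by
  rw [Fintype.card_piFinset_const, Int.card_Icc]
  congr 1
  omega

/-- The configurations whose mean squared cube counts, around every lattice point, are eventually
at most `t`. -/
def densityAtMost (d t : ℕ) : Set (Configuration d) :=
  {γ | ∀ a : Fin d → ℤ, ∀ᶠ l : ℕ in atTop,
    ∑ r ∈ latticeBox d l, cubeCount (r + a) γ ^ 2 ≤ (t * (2 * l + 1) ^ d : ℕ)}

lemma measurableSet_densityAtMost (d t : ℕ) : MeasurableSet (densityAtMost d t) := by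
  have h : densityAtMost d t = ⋂ a : Fin d → ℤ, ⋃ n : ℕ, ⋂ l : ℕ, ⋂ _ : n ≤ l,
      {γ | ∑ r ∈ latticeBox d l, cubeCount (r + a) γ ^ 2 ≤ (t * (2 * l + 1) ^ d : ℕ)} := by
    ext γ
    simp only [densityAtMost, eventually_atTop, mem_ofPred_eq, mem_iInter, mem_iUnion]
  rw [h]
  refine MeasurableSet.iInter fun a => MeasurableSet.iUnion fun n => MeasurableSet.iInter fun l =>
    MeasurableSet.iInter fun _ => measurableSet_le ?_ measurable_const
  exact Finset.measurable_fun_sum _ fun r _ => (measurable_cubeCount _).pow_const 2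

lemma densityAtMost_mono (d : ℕ) : Monotone (densityAtMost d) := by
  intro s t hst γ hγ a
  filter_upwards [hγ a] with l hl
  exact hl.trans (by gcongr)

/-- Quantifying over all centres makes the set exactly invariant, with the same `t`, so stationarity
survives restriction to it. -/
lemma translate_mem_densityAtMost (b : Fin d → ℤ) (t : ℕ) (γ : Configuration d) :
    translate (latticePoint b) γ ∈ densityAtMost d t ↔ γ ∈ densityAtMost d t := by
  simp only [densityAtMost, mem_ofPred_eq, cubeCount_translate, add_sub_assoc]
  exact (Equiv.subRight b).forall_congr fun a => Iff.rfl

lemma Configuration.IsTempered.exists_mem_densityAtMost {γ : Configuration d}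
    (hγ : γ.IsTempered) : ∃ t, γ ∈ densityAtMost d t := by
  obtain ⟨t, ht⟩ := hγ
  obtain ⟨T, hT⟩ := exists_nat_ge t
  -- Recentring at `a` enlarges the box from `l` to `l + k`, and `2 (l + k) + 1 ≤ 2 (2 l + 1)` once
  -- `l ≥ k`.
  refine ⟨T * 2 ^ d, fun a => ?_⟩
  set k := ∑ i, (a i).natAbs
  filter_upwards [eventually_ge_atTop k] with l hl
  have hk : ∀ i, (a i).natAbs ≤ k := fun i =>
    Finset.single_le_sum (f := fun i => (a i).natAbs) (fun _ _ => Nat.zero_le _)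
      (Finset.mem_univ i)
  have h1 : ∑ r ∈ latticeBox d l, (γ.carrier ∩ unitCube (r + a)).ncard ^ 2
      ≤ ∑ r ∈ latticeBox d (l + k), (γ.carrier ∩ unitCube r).ncard ^ 2 := by
    refine (Finset.sum_map (latticeBox d l) (addRightEmbedding a)
      fun r => (γ.carrier ∩ unitCube r).ncard ^ 2).symm.trans_le ?_
    refine Finset.sum_le_sum_of_subset fun r hr => ?_
    obtain ⟨s, hs, rfl⟩ := Finset.mem_map.1 hr
    rw [Fintype.mem_piFinset] at hs ⊢
    intro i
    have h1 := Finset.mem_Icc.1 (hs i)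
    have h2 := hk i
    simp only [addRightEmbedding_apply, Pi.add_apply, Finset.mem_Icc]
    omega
  have h2 : ∑ r ∈ latticeBox d (l + k), (γ.carrier ∩ unitCube r).ncard ^ 2
      ≤ T * (2 * (l + k) + 1) ^ d := by
    have h3 := (ht (l + k)).trans (mul_le_mul_of_nonneg_right hT (by positivity))
    exact_mod_cast h3
  have h4 : T * (2 * (l + k) + 1) ^ d ≤ T * 2 ^ d * (2 * l + 1) ^ d := by
    rw [mul_assoc, ← mul_pow]
    gcongr
    omega
  simp_rw [cubeCount_eq_ncard]
  exact_mod_cast h1.trans (h2.trans h4)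

lemma IsTranslationInvariant.lintegral_translate {P : Measure (Configuration d)}
    (hP : IsTranslationInvariant P) (a : Space d) {f : Configuration d → ℝ≥0∞}
    (hf : Measurable f) : ∫⁻ γ, f (translate a γ) ∂P = ∫⁻ γ, f γ ∂P := by
  rw [← lintegral_map hf (measurable_translate a), hP a]

lemma IsTranslationInvariant.setLIntegral_cubeCount {P : Measure (Configuration d)}
    (hP : IsTranslationInvariant P) (t : ℕ) {g : ℝ≥0∞ → ℝ≥0∞} (hg : Measurable g)
    (r : Fin d → ℤ) :
    ∫⁻ γ in densityAtMost d t, g (cubeCount r γ) ∂P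
      = ∫⁻ γ in densityAtMost d t, g (cubeCount 0 γ) ∂P := by
  have hG := measurableSet_densityAtMost d t
  rw [← lintegral_indicator hG, ← lintegral_indicator hG]
  refine (hP.lintegral_translate (latticePoint r)
    ((hg.comp (measurable_cubeCount r)).indicator hG)).symm.trans ?_
  refine lintegral_congr fun γ => ?_
  by_cases hγ : γ ∈ densityAtMost d t
  · rw [indicator_of_mem hγ, indicator_of_mem ((translate_mem_densityAtMost r t γ).2 hγ),
      Function.comp_apply, cubeCount_translate, sub_self]
  · rw [indicator_of_notMem hγ,
      indicator_of_notMem (mt (translate_mem_densityAtMost r t γ).1 hγ)]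

/-- By stationarity the spatial averages of the squared counts all have the same integral, while
their upper limit is at most `t` on this set. Truncation at `M` supplies the domination for the
reverse Fatou lemma and is removed by monotone convergence. -/
lemma setLIntegral_sq_cubeCount_le {P : Measure (Configuration d)} [IsProbabilityMeasure P]
    (hP : IsTranslationInvariant P) (t : ℕ) :
    ∫⁻ γ in densityAtMost d t, cubeCount 0 γ ^ 2 ∂P ≤ t := by
  have hG := measurableSet_densityAtMost d t
  have htrunc : ∀ M : ℕ, ∫⁻ γ in densityAtMost d t, min (cubeCount 0 γ ^ 2) M ∂P ≤ t := by
    intro M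
    set A : ℕ → Configuration d → ℝ≥0∞ := fun l γ =>
      (∑ r ∈ latticeBox d l, min (cubeCount r γ ^ 2) M) / ((2 * l + 1) ^ d : ℕ)
    have hm : ∀ r : Fin d → ℤ, Measurable fun γ => min (cubeCount r γ ^ 2) (M : ℝ≥0∞) :=
      fun r => ((measurable_cubeCount r).pow_const 2).min measurable_const
    have hpos : ∀ l : ℕ, ((2 * l + 1) ^ d : ℕ) ≠ 0 := fun l => by positivity
    have hA : ∀ l, ∫⁻ γ in densityAtMost d t, A l γ ∂P
        = ∫⁻ γ in densityAtMost d t, min (cubeCount 0 γ ^ 2) M ∂P := by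
      intro l
      simp only [A, div_eq_mul_inv]
      rw [lintegral_mul_const _ (Finset.measurable_fun_sum _ fun r _ => hm r),
        lintegral_finsetSum _ fun r _ => hm r]
      simp_rw [hP.setLIntegral_cubeCount t (g := fun a => min (a ^ 2) (M : ℝ≥0∞))
        ((measurable_id.pow_const 2).min measurable_const)]
      rw [Finset.sum_const, card_latticeBox, nsmul_eq_mul, mul_comm, ← mul_assoc,
        ENNReal.inv_mul_cancel (by exact_mod_cast hpos l) (ENNReal.natCast_ne_top _), one_mul]
    have hAle : ∀ l γ, A l γ ≤ M := by
      intro l γ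
      refine ENNReal.div_le_of_le_mul ?_
      calc ∑ r ∈ latticeBox d l, min (cubeCount r γ ^ 2) (M : ℝ≥0∞)
          ≤ ∑ _r ∈ latticeBox d l, (M : ℝ≥0∞) := Finset.sum_le_sum fun _ _ => min_le_right _ _
        _ = M * ((2 * l + 1) ^ d : ℕ) := by
          rw [Finset.sum_const, card_latticeBox, nsmul_eq_mul, mul_comm]
    have hlim := limsup_lintegral_le (μ := P.restrict (densityAtMost d t)) (f := A)
      (fun _ => (M : ℝ≥0∞))
      (fun l => (Finset.measurable_fun_sum _ fun r _ => hm r).div_const _)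
      (fun l => ae_of_all _ (hAle l)) (by
        rw [lintegral_const]
        exact ENNReal.mul_ne_top (ENNReal.natCast_ne_top _) (measure_ne_top _ _))
    simp_rw [hA] at hlim
    rw [limsup_const] at hlim
    refine hlim.trans ?_
    calc ∫⁻ γ in densityAtMost d t, limsup (fun l => A l γ) atTop ∂P
        ≤ ∫⁻ _γ in densityAtMost d t, (t : ℝ≥0∞) ∂P := by
          refine setLIntegral_mono' hG fun γ hγ => ?_
          refine limsup_le_of_le (by isBoundedDefault) ?_
          filter_upwards [hγ 0] with l hl
          refine ENNReal.div_le_of_le_mul ?_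
          simp only [add_zero] at hl
          push_cast at hl ⊢
          exact (Finset.sum_le_sum fun _ _ => min_le_left _ _).trans hl
      _ ≤ t := by
          rw [setLIntegral_const]
          exact mul_le_of_le_one_right zero_le prob_le_one
  have hsup : ∀ γ : Configuration d, cubeCount 0 γ ^ 2
      = ⨆ M : ℕ, min (cubeCount 0 γ ^ 2) (M : ℝ≥0∞) := by
    intro γ
    exact ((inf_iSup_eq (cubeCount 0 γ ^ 2) fun M : ℕ => (M : ℝ≥0∞)).symm.trans
      (by rw [ENNReal.iSup_natCast, inf_top_eq])).symm
  rw [lintegral_congr hsup, lintegral_iSup (fun M => ((measurable_cubeCount 0).pow_const 2).min measurable_const)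
    (fun M M' h γ => min_le_min le_rfl (by exact_mod_cast h))]
  exact iSup_le htrunc

lemma mul_le_sq_add_sq (a b : ℝ≥0∞) : a * b ≤ a ^ 2 + b ^ 2 := by
  rcases le_total a b with h | h
  · exact (mul_le_mul_left h b).trans (by rw [← sq]; exact le_add_self)
  · exact (mul_le_mul_right h a).trans (by rw [← sq]; exact le_self_add)

lemma lintegral_cubeCount_mul_tsum_le (Q : Measure (Configuration d)) {m : ℝ≥0∞}
    (hm : ∀ s : Fin d → ℤ, ∫⁻ γ, cubeCount s γ ^ 2 ∂Q = m) (c : (Fin d → ℤ) → ℝ≥0∞) :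
    ∫⁻ γ, cubeCount 0 γ * ∑' s, c s * cubeCount s γ ∂Q ≤ (∑' s, c s) * (2 * m) := by
  have hmeas : ∀ s : Fin d → ℤ, Measurable fun γ : Configuration d => cubeCount s γ ^ 2 :=
    fun s => (measurable_cubeCount s).pow_const 2
  have hadd : ∀ s : Fin d → ℤ, Measurable fun γ : Configuration d =>
    cubeCount 0 γ ^ 2 + cubeCount s γ ^ 2 := fun s => (hmeas 0).add (hmeas s)
  calc ∫⁻ γ, cubeCount 0 γ * ∑' s, c s * cubeCount s γ ∂Q
      ≤ ∫⁻ γ, ∑' s, c s * (cubeCount 0 γ ^ 2 + cubeCount s γ ^ 2) ∂Q := by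
        refine lintegral_mono fun γ => ?_
        rw [← ENNReal.tsum_mul_left]
        refine ENNReal.tsum_le_tsum fun s => ?_
        rw [mul_left_comm]
        exact mul_le_mul_right (mul_le_sq_add_sq _ _) _
    _ = ∑' s, c s * (2 * m) := by
        rw [lintegral_tsum fun s => ((hadd s).const_mul _).aemeasurable]
        refine tsum_congr fun s => ?_
        rw [lintegral_const_mul _ (hadd s), lintegral_add_left (hmeas 0), hm, hm, two_mul]
    _ = (∑' s, c s) * (2 * m) := ENNReal.tsum_mul_right

/-- An invariant Gibbs measure has finite second moments. -/
theorem IsInvariantGibbs.lintegral_sq_cubeCount_ne_top (hd : 0 < d)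
    {P : Measure (Configuration d)} (hP : IsInvariantGibbs P) :
    ∫⁻ γ, cubeCount 0 γ ^ 2 ∂P ≠ ⊤ := by
  obtain ⟨hinv, β, μ, v, hβ, hv, hG⟩ := hP
  have := hG.isProbabilityMeasure
  obtain ⟨c, hcs, hc⟩ := hv.exists_lower_bound hd
  set C := (∑' s, (c s : ℝ≥0∞)).toReal
  have hC : ∑' s, (c s : ℝ≥0∞) = ENNReal.ofReal C := (ENNReal.ofReal_toReal hcs).symm
  have hC0 : 0 ≤ C := ENNReal.toReal_nonneg
  -- The cross term costs `2βC` times the second moment and the linear term costs one more. The last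
  -- unit is what remains on the left.
  set K := 2 * β * C + 2
  have hK : 0 ≤ K := by positivity
  obtain ⟨B, hB⟩ := hv.superstable hd (2 * K / β)
  set B' := max (β * B / 2 + β * μ) 0
  have hB0 : 0 ≤ B' := le_max_right _ _
  set E := ∑' N : ℕ, ENNReal.ofReal (1 / N.factorial)
  have hE : E ≠ ⊤ := by
    have := (Real.summable_pow_div_factorial 1).tsum_ofReal_ne_top
    simpa [E] using this
  have hF : ∫⁻ γ, cubeEnergyBound β K B' c γ ∂P ≤ E :=
    hG.lintegral_le hd (measurableSet_unitCube 0) (isBounded_unitCube 0) (volume_unitCube 0)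
      (measurable_cubeEnergyBound β K B' c) fun N x hinj hx γ hγ =>
        cubeEnergyBound_mul_boltzmann_le hv.ne_bot hβ hc hB hK hB0 (le_max_left _ _) hinj hx hγ
  have hmS : Measurable fun γ : Configuration d => ∑' s, (c s : ℝ≥0∞) * cubeCount s γ :=
    Measurable.tsum fun s => (measurable_cubeCount s).const_mul _
  have hm0 := measurable_cubeCount (d := d) 0
  have hm1 : Measurable fun γ : Configuration d =>
    cubeCount 0 γ * ∑' s, (c s : ℝ≥0∞) * cubeCount s γ := hm0.mul hmS
  have hm2 : Measurable fun γ : Configuration d => ENNReal.ofReal β *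
    (cubeCount 0 γ * ∑' s, (c s : ℝ≥0∞) * cubeCount s γ) := hm1.const_mul _
  have hbound : ∀ t : ℕ, ∫⁻ γ in densityAtMost d t, cubeCount 0 γ ^ 2 ∂P
      ≤ E + ENNReal.ofReal B' ^ 2 := by
    intro t
    set m := ∫⁻ γ in densityAtMost d t, cubeCount 0 γ ^ 2 ∂P
    have hm : m ≠ ⊤ := ne_top_of_le_ne_top (ENNReal.natCast_ne_top t)
      (setLIntegral_sq_cubeCount_le hinv t)
    have hms : ∀ s : Fin d → ℤ, ∫⁻ γ in densityAtMost d t, cubeCount s γ ^ 2 ∂P = m := fun s =>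
      hinv.setLIntegral_cubeCount t (g := fun a => a ^ 2) (measurable_id.pow_const 2) s
    have hcross : ∫⁻ γ in densityAtMost d t,
        cubeCount 0 γ * ∑' s, (c s : ℝ≥0∞) * cubeCount s γ ∂P ≤ ENNReal.ofReal C * (2 * m) := by
      rw [← hC]
      exact lintegral_cubeCount_mul_tsum_le _ hms _
    have hlin : ∫⁻ γ in densityAtMost d t, ENNReal.ofReal B' * cubeCount 0 γ ∂P
        ≤ ENNReal.ofReal B' ^ 2 + m := by
      refine (lintegral_mono fun γ => mul_le_sq_add_sq _ _).trans ?_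
      rw [lintegral_add_left measurable_const, setLIntegral_const]
      exact add_le_add (mul_le_of_le_one_right zero_le prob_le_one) le_rfl
    have hmain : ENNReal.ofReal K * m ≤ E + (ENNReal.ofReal β * (ENNReal.ofReal C * (2 * m)) +
        (ENNReal.ofReal B' ^ 2 + m)) := by
      calc ENNReal.ofReal K * m
          = ∫⁻ γ in densityAtMost d t, ENNReal.ofReal K * cubeCount 0 γ ^ 2 ∂P := by
            rw [lintegral_const_mul _ (hm0.pow_const 2)]
        _ ≤ ∫⁻ γ in densityAtMost d t, (cubeEnergyBound β K B' c γ + (ENNReal.ofReal β *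
            (cubeCount 0 γ * ∑' s, (c s : ℝ≥0∞) * cubeCount s γ) +
              ENNReal.ofReal B' * cubeCount 0 γ)) ∂P :=
            lintegral_mono fun γ => le_tsub_add
        _ = ∫⁻ γ in densityAtMost d t, cubeEnergyBound β K B' c γ ∂P + (ENNReal.ofReal β *
            ∫⁻ γ in densityAtMost d t, cubeCount 0 γ * ∑' s, (c s : ℝ≥0∞) * cubeCount s γ ∂P +
            ∫⁻ γ in densityAtMost d t, ENNReal.ofReal B' * cubeCount 0 γ ∂P) := by
            rw [lintegral_add_left (measurable_cubeEnergyBound _ _ _ _),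
              lintegral_add_left hm2, lintegral_const_mul _ hm1]
        _ ≤ _ := by
            gcongr
            exact (setLIntegral_le_lintegral _ _).trans hF
    have h1 : ENNReal.ofReal K * m = m + ENNReal.ofReal (2 * β * C + 1) * m := by
      rw [← one_add_mul, ← ENNReal.ofReal_one, ← ENNReal.ofReal_add zero_le_one (by positivity)]
      congr 2
      simp only [K]
      ring
    have h2 : E + (ENNReal.ofReal β * (ENNReal.ofReal C * (2 * m)) + (ENNReal.ofReal B' ^ 2 + m))
        = E + ENNReal.ofReal B' ^ 2 + ENNReal.ofReal (2 * β * C + 1) * m := by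
      rw [ENNReal.ofReal_add (by positivity) zero_le_one, ENNReal.ofReal_mul (by positivity),
        ENNReal.ofReal_mul zero_le_two, ENNReal.ofReal_ofNat, ENNReal.ofReal_one]
      ring
    rw [h1, h2] at hmain
    -- Here the a priori finiteness of `m` on the restricted set permits the cancellation.
    exact (ENNReal.add_le_add_iff_right (ENNReal.mul_ne_top ENNReal.ofReal_ne_top hm)).1 hmain
  -- Temperedness gives the exhaustion, and the bound uniform in `t` passes to the increasing limit.
  have hU : ∀ᵐ γ ∂P, γ ∈ ⋃ t, densityAtMost d t := by
    filter_upwards [hG.tempered] with γ hγ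
    exact mem_iUnion.2 hγ.exists_mem_densityAtMost
  have hfin : ∫⁻ γ, cubeCount 0 γ ^ 2 ∂P ≤ E + ENNReal.ofReal B' ^ 2 := by
    rw [← Measure.restrict_eq_self_of_ae_mem hU, setLIntegral_iUnion_of_directed _
      (densityAtMost_mono d).directed_le]
    exact iSup_le hbound
  exact ne_top_of_le_ne_top (ENNReal.add_ne_top.2 ⟨hE, by finiteness⟩) hfin

lemma IsTranslationInvariant.lintegral_cubeCount {P : Measure (Configuration d)}
    (hP : IsTranslationInvariant P) {g : ℝ≥0∞ → ℝ≥0∞} (hg : Measurable g) (r : Fin d → ℤ) :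
    ∫⁻ γ, g (cubeCount r γ) ∂P = ∫⁻ γ, g (cubeCount 0 γ) ∂P := by
  refine (hP.lintegral_translate (latticePoint r)
    (hg.comp (measurable_cubeCount r))).symm.trans ?_
  simp [cubeCount_translate]

/-- Weighted sums of products of cube counts have finite expectation. -/
lemma IsInvariantGibbs.lintegral_cubeCount_mul_ne_top (hd : 0 < d)
    {P : Measure (Configuration d)} (hP : IsInvariantGibbs P) {c : (Fin d → ℤ) → ℝ≥0∞}
    (hc : ∑' s, c s ≠ ⊤) :
    ∫⁻ γ, cubeCount 0 γ * ∑' s, c s * cubeCount s γ ∂P ≠ ⊤ := by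
  have hm := hP.lintegral_sq_cubeCount_ne_top hd
  set m := ∫⁻ γ, cubeCount 0 γ ^ 2 ∂P
  have hms : ∀ s : Fin d → ℤ, ∫⁻ γ, cubeCount s γ ^ 2 ∂P = m := fun s =>
    hP.1.lintegral_cubeCount (g := fun a => a ^ 2) (measurable_id.pow_const 2) s
  exact ne_top_of_le_ne_top (by finiteness) (lintegral_cubeCount_mul_tsum_le P hms c)

/-! ### The second factorial moment measure -/

/-- The second factorial moment measure. -/
noncomputable def pairMeasure (P : Measure (Configuration d)) : Measure (Space d × Space d) :=
  ((pointKernel d ×ₖ pointKernel d) ∘ₘ P).restrict {p | p.1 ≠ p.2}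

instance (P : Measure (Configuration d)) [SFinite P] : SFinite (pairMeasure P) := by
  unfold pairMeasure; infer_instance

lemma lintegral_pairMeasure (P : Measure (Configuration d)) {f : Space d × Space d → ℝ≥0∞}
    (hf : Measurable f) : ∫⁻ p, f p ∂(pairMeasure P) = ∫⁻ γ, pairSum f γ ∂P := by
  have hg := hf.indicator (measurableSet_offDiag (d := d))
  rw [pairMeasure, ← lintegral_indicator measurableSet_offDiag,
    Measure.lintegral_bind (Kernel.aemeasurable _) hg.aemeasurable]
  refine lintegral_congr fun γ => ?_
  rw [Kernel.lintegral_prod _ _ _ hg, pairSum_eq_lintegral]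
  rfl

lemma IsTranslationInvariant.lintegral_pairMeasure_add {P : Measure (Configuration d)}
    (hP : IsTranslationInvariant P) (a : Space d) {f : Space d × Space d → ℝ≥0∞}
    (hf : Measurable f) :
    ∫⁻ p, f (p.1 + a, p.2 + a) ∂(pairMeasure P) = ∫⁻ p, f p ∂(pairMeasure P) := by
  have hf' : Measurable fun p : Space d × Space d => f (p.1 + a, p.2 + a) := by fun_prop
  rw [lintegral_pairMeasure P hf', lintegral_pairMeasure P hf,
    ← hP.lintegral_translate a (measurable_pairSum hf)]
  exact lintegral_congr fun γ => (pairSum_translate a γ f).symm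

/-- In the equilibrium equation of a box, the exterior configuration has no points inside, so any
pair in the box consists of two of the integration variables. For almost every tuple such pairs
avoid a given null set. -/
lemma IsTemperedGibbs.pairMeasure_absolutelyContinuous {β μ : ℝ} {v : Space d → EReal}
    {P : Measure (Configuration d)} (hP : IsTemperedGibbs β μ v P) :
    pairMeasure P ≪ volume := by
  refine Measure.AbsolutelyContinuous.mk fun A hA hA0 => ?_
  have hcover : A = ⋃ l : ℕ, A ∩ (box d l ×ˢ box d l) := by
    rw [← inter_iUnion, eq_comm, inter_eq_left]
    intro p _
    obtain ⟨l, hl⟩ := exists_nat_ge (max ‖p.1‖ ‖p.2‖)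
    refine mem_iUnion.2 ⟨l, fun i => ?_, fun i => ?_⟩
    · exact (PiLp.norm_apply_le p.1 i).trans ((le_max_left _ _).trans hl)
    · exact (PiLp.norm_apply_le p.2 i).trans ((le_max_right _ _).trans hl)
  rw [hcover, measure_iUnion_null_iff]
  intro l
  have hm : MeasurableSet (A ∩ (box d l ×ˢ box d l)) :=
    hA.inter ((measurableSet_box _).prod (measurableSet_box _))
  have hf : Measurable ((A ∩ (box d l ×ˢ box d l)).indicator (1 : Space d × Space d → ℝ≥0∞)) :=
    measurable_one.indicator hm
  rw [← lintegral_indicator_one hm, lintegral_pairMeasure P hf,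
    hP.equilibrium (box d l) (measurableSet_box _) (isBounded_box d _) _ (measurable_pairSum hf)]
  refine ENNReal.tsum_eq_zero.2 fun N => mul_eq_zero_of_right _ ?_
  refine (lintegral_congr_ae (g := 0) ?_).trans lintegral_zero
  filter_upwards [ae_restrict_of_ae (ae_pair_notMem hA0 N)] with x hx
  refine mul_eq_zero_of_left ?_ _
  refine (setLIntegral_congr_fun (g := 0)
    (measurableSet_subset_compl (measurableSet_box _) (isBounded_box d _)) ?_).trans lintegral_zero
  intro γ hγ
  refine mul_eq_zero_of_left ?_ _
  refine ENNReal.tsum_eq_zero.2 ?_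
  rintro ⟨⟨y, z⟩, hy, hz, hyz⟩
  refine indicator_of_notMem ?_ _
  rintro ⟨hyzA, hyb, hzb⟩
  simp only at hy hz hyz hyzA hyb hzb
  rcases hy with hy | ⟨i, hi⟩
  · exact hγ hy hyb
  rcases hz with hz | ⟨j, hj⟩
  · exact hγ hz hzb
  exact hx i j (fun h => hyz (by rw [← hi, ← hj, h])) (by rw [hi, hj]; exact hyzA)

/-- Reduces integrability against the pair measure to moments of cube counts, for functions
dominated cell by cell. -/
lemma lintegral_pairMeasure_le (P : Measure (Configuration d)) {f : Space d × Space d → ℝ≥0∞}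
    (hf : Measurable f) (c : (Fin d → ℤ) → ℝ≥0∞)
    (hfc : ∀ p : Space d × Space d, p.1 ≠ p.2 →
      f p ≤ (unitCube 0).indicator 1 p.2 * c (cubeIndex p.1)) :
    ∫⁻ p, f p ∂(pairMeasure P) ≤ ∫⁻ γ, cubeCount 0 γ * ∑' s, c s * cubeCount s γ ∂P := by
  rw [lintegral_pairMeasure P hf]
  refine lintegral_mono fun γ => ?_
  rw [pairSum_eq_lintegral, tsum_mul_cubeCount]
  calc _ ≤ ∫⁻ x, ∫⁻ y, c (cubeIndex x) * (unitCube 0).indicator 1 y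
        ∂γ.pointMeasure ∂γ.pointMeasure := by
        refine lintegral_mono fun x => lintegral_mono fun y => ?_
        by_cases hxy : x ≠ y
        · rw [indicator_of_mem (show (x, y) ∈ {p : Space d × Space d | p.1 ≠ p.2} from hxy),
            mul_comm]
          exact hfc (x, y) hxy
        · rw [indicator_of_notMem (fun h => hxy h)]
          exact zero_le
    _ = ∫⁻ x, c (cubeIndex x) * cubeCount 0 γ ∂γ.pointMeasure := by
        refine lintegral_congr fun x => ?_
        rw [lintegral_const_mul _ (measurable_one.indicator (measurableSet_unitCube 0)),
          lintegral_indicator_one (measurableSet_unitCube 0)]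
        rfl
    _ = _ := by
        have hm : Measurable fun x : Space d => c (cubeIndex x) :=
          (Measurable.of_discrete (f := c)).comp measurable_cubeIndex
        rw [lintegral_mul_const _ hm, lintegral_pointMeasure, mul_comm]

/-- The reduced second moment measure: the law of the differences `x - y` of pairs of points with
`y` in the central unit cube. -/
noncomputable def reducedMeasure (P : Measure (Configuration d)) : Measure (Space d) :=
  ((pairMeasure P).restrict {p | p.2 ∈ unitCube 0}).map fun p => p.1 - p.2

lemma measurableSet_snd_mem : MeasurableSet {p : Space d × Space d | p.2 ∈ unitCube 0} :=
  measurable_snd (measurableSet_unitCube 0)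

instance (P : Measure (Configuration d)) [SFinite P] : SFinite (reducedMeasure P) := by
  unfold reducedMeasure; infer_instance

lemma lintegral_reducedMeasure (P : Measure (Configuration d)) {f : Space d → ℝ≥0∞}
    (hf : Measurable f) : ∫⁻ w, f w ∂(reducedMeasure P)
      = ∫⁻ p, (unitCube 0).indicator 1 p.2 * f (p.1 - p.2) ∂(pairMeasure P) := by
  rw [reducedMeasure, lintegral_map hf (by fun_prop),
    ← lintegral_indicator measurableSet_snd_mem]
  refine lintegral_congr fun p => ?_
  by_cases hp : p.2 ∈ unitCube 0
  · rw [indicator_of_mem (show p ∈ {p : Space d × Space d | p.2 ∈ unitCube 0} from hp),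
      indicator_of_mem hp]
    simp
  · rw [indicator_of_notMem (show p ∉ {p : Space d × Space d | p.2 ∈ unitCube 0} from hp),
      indicator_of_notMem hp, zero_mul]

lemma IsInvariantGibbs.sigmaFinite_reducedMeasure (hd : 0 < d) {P : Measure (Configuration d)}
    (hP : IsInvariantGibbs P) : SigmaFinite (reducedMeasure P) := by
  refine Measure.sigmaFinite_of_countable (S := range (unitCube : (Fin d → ℤ) → Set (Space d)))
    (countable_range _) ?_ (by rw [sUnion_range, iUnion_unitCube])
  rintro _ ⟨s, rfl⟩
  have hms := measurableSet_unitCube (d := d) s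
  rw [← lintegral_indicator_one hms, lintegral_reducedMeasure P (measurable_one.indicator hms)]
  -- If `y` is in the central cube and `x - y` in the cube of `s`, then `x` lies in one of the `3 ^
  -- d` cubes around `s`. The indicator of these is a summable weight.
  set T : Finset (Fin d → ℤ) := Fintype.piFinset fun i => Finset.Icc (s i - 1) (s i + 1)
  set c : (Fin d → ℤ) → ℝ≥0∞ := (T : Set (Fin d → ℤ)).indicator 1
  have hc : ∑' s, c s ≠ ⊤ := by
    simp only [c]
    rw [← tsum_subtype, Finset.tsum_subtype' T]
    simp
  refine lt_of_le_of_lt (lintegral_pairMeasure_le P ?_ c ?_)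
    (hP.lintegral_cubeCount_mul_ne_top hd hc).lt_top
  · exact ((measurable_one.indicator (measurableSet_unitCube 0)).comp measurable_snd).mul
      ((measurable_one.indicator hms).comp (measurable_fst.sub measurable_snd))
  · rintro ⟨x, y⟩ -
    by_cases hy : y ∈ unitCube 0
    · refine mul_le_mul_right ?_ _
      by_cases hxy : x - y ∈ unitCube s
      · have hT : cubeIndex x ∈ (T : Set (Fin d → ℤ)) := by
          rw [Finset.mem_coe, Fintype.mem_piFinset]
          intro i
          have h1 := hy i
          have h2 := hxy i
          simp only [Pi.zero_apply, Int.cast_zero, PiLp.sub_apply] at h1 h2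
          rw [Finset.mem_Icc, cubeIndex, Int.le_floor, ← Int.lt_add_one_iff, Int.floor_lt]
          push_cast
          constructor <;> linarith [h1.1, h1.2, h2.1, h2.2]
        rw [indicator_of_mem hxy]
        simp only [c]
        rw [indicator_of_mem hT]
        simp
      · rw [indicator_of_notMem hxy]
        exact zero_le
    · simp [hy]

/-- Subtraction is a surjective linear map, so it carries Lebesgue measure to a multiple of Lebesgue
measure and preserves absolute continuity. -/
lemma IsTemperedGibbs.reducedMeasure_absolutelyContinuous {β μ : ℝ} {v : Space d → EReal}
    {P : Measure (Configuration d)} (hP : IsTemperedGibbs β μ v P) :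
    reducedMeasure P ≪ volume := by
  have hm : Measurable fun p : Space d × Space d => p.1 - p.2 := measurable_fst.sub measurable_snd
  have h1 : reducedMeasure P ≪ (volume : Measure (Space d × Space d)).map fun p => p.1 - p.2 :=
    (Measure.absolutelyContinuous_of_le Measure.restrict_le_self |>.trans
      hP.pairMeasure_absolutelyContinuous).map hm
  have : (volume : Measure (Space d × Space d)).IsAddHaarMeasure := by
    rw [Measure.volume_eq_prod]; infer_instance
  let L : Space d × Space d →ₗ[ℝ] Space d := LinearMap.fst ℝ _ _ - LinearMap.snd ℝ _ _
  have hL : Function.Surjective L := fun a => ⟨(a, 0), by simp [L]⟩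
  obtain ⟨c, -, hc⟩ := L.exists_map_addHaar_eq_smul_addHaar volume volume hL
  have h2 : (volume : Measure (Space d × Space d)).map (fun p => p.1 - p.2) = c • volume := hc
  rw [h2] at h1
  exact h1.trans (Measure.smul_absolutelyContinuous)

/-- Disintegration of the second factorial moment measure along the diagonal translations. -/
lemma IsTranslationInvariant.lintegral_pairMeasure_eq {P : Measure (Configuration d)} [SFinite P]
    (hP : IsTranslationInvariant P) {f : Space d × Space d → ℝ≥0∞} (hf : Measurable f) :
    ∫⁻ p, f p ∂(pairMeasure P) = ∫⁻ w, (∫⁻ a, f (w + a, a)) ∂(reducedMeasure P) := by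
  set q : Space d → ℝ≥0∞ := (unitCube 0).indicator 1
  have hq : Measurable q := measurable_one.indicator (measurableSet_unitCube 0)
  have hq1 : ∀ y : Space d, ∫⁻ a, q (y - a) = 1 := by
    intro y
    rw [lintegral_sub_left_eq_self q y, lintegral_indicator_one (measurableSet_unitCube 0),
      volume_unitCube]
  have hm : Measurable fun w : Space d => ∫⁻ a, f (w + a, a) :=
    Measurable.lintegral_prod_right' (f := fun z : Space d × Space d => f (z.1 + z.2, z.2))
      (by fun_prop)
  calc ∫⁻ p, f p ∂(pairMeasure P)
      -- Insert `∫ q (y - a) da = 1`, then translate both points by `a`: the second is thereby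
      -- confined to the central cube.
      = ∫⁻ p, (∫⁻ a, f p * q (p.2 - a)) ∂(pairMeasure P) := by
        refine lintegral_congr fun p => ?_
        rw [lintegral_const_mul _ (by fun_prop), hq1, mul_one]
    _ = ∫⁻ a, ∫⁻ p, f p * q (p.2 - a) ∂(pairMeasure P) :=
        lintegral_lintegral_swap (by fun_prop)
    _ = ∫⁻ a, ∫⁻ p, f (p.1 + a, p.2 + a) * q p.2 ∂(pairMeasure P) := by
        refine lintegral_congr fun a => ?_
        rw [← hP.lintegral_pairMeasure_add a (by fun_prop)]
        simp only [add_sub_cancel_right]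
    _ = ∫⁻ p, (∫⁻ a, f (p.1 + a, p.2 + a) * q p.2) ∂(pairMeasure P) :=
        (lintegral_lintegral_swap (by fun_prop)).symm
    _ = ∫⁻ p, q p.2 * (∫⁻ a, f (p.1 - p.2 + a, a)) ∂(pairMeasure P) := by
        refine lintegral_congr fun p => ?_
        rw [lintegral_mul_const _ (by fun_prop), mul_comm]
        congr 1
        rw [← lintegral_add_right_eq_self (fun a => f (p.1 - p.2 + a, a)) p.2]
        refine lintegral_congr fun a => ?_
        congr 2 <;> abel
    _ = ∫⁻ w, (∫⁻ a, f (w + a, a)) ∂(reducedMeasure P) := (lintegral_reducedMeasure P hm).symm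

lemma lintegral_mul_comp_sub {g : Space d → ℝ≥0∞} (hg : Measurable g)
    {f : Space d × Space d → ℝ≥0∞} (hf : Measurable f) :
    ∫⁻ p : Space d × Space d, f p * g (p.1 - p.2) = ∫⁻ w, g w * ∫⁻ a, f (w + a, a) := by
  rw [Measure.volume_eq_prod, lintegral_prod_symm _ (by fun_prop)]
  calc ∫⁻ a, ∫⁻ x, f (x, a) * g (x - a)
      = ∫⁻ a, ∫⁻ w, g w * f (w + a, a) := by
        refine lintegral_congr fun a => ?_
        rw [← lintegral_add_right_eq_self (fun x => f (x, a) * g (x - a)) a]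
        refine lintegral_congr fun w => ?_
        rw [add_sub_cancel_right, mul_comm]
    _ = ∫⁻ w, ∫⁻ a, g w * f (w + a, a) := lintegral_lintegral_swap (by fun_prop)
    _ = _ := by
        refine lintegral_congr fun w => ?_
        rw [lintegral_const_mul _ (by fun_prop)]

/-- Existence of the pair correlation function. -/
theorem IsInvariantGibbs.exists_isPairCorrelation (hd : 0 < d) {P : Measure (Configuration d)}
    (hP : IsInvariantGibbs P) : ∃ ρ : Space d → Space d → ℝ≥0, IsPairCorrelation P ρ := by
  have hσ := hP.sigmaFinite_reducedMeasure hd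
  obtain ⟨hinv, β, μ, v, hβ, hv, hG⟩ := hP
  have := hG.isProbabilityMeasure
  have hac := hG.reducedMeasure_absolutelyContinuous
  set g₀ := (reducedMeasure P).rnDeriv volume
  have hg₀ : Measurable g₀ := Measure.measurable_rnDeriv _ _
  set g : Space d → ℝ≥0 := fun w => (g₀ w).toNNReal
  have hg : Measurable g := hg₀.ennreal_toNNReal
  -- σ-finiteness makes the density finite almost everywhere, so passing to `ℝ≥0` values changes it
  -- only on a null set.
  have hgg : (fun w => (g w : ℝ≥0∞)) =ᵐ[volume] g₀ := by
    filter_upwards [Measure.rnDeriv_lt_top (reducedMeasure P) volume] with w hw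
    exact ENNReal.coe_toNNReal hw.ne
  have hdens : reducedMeasure P = volume.withDensity fun w => (g w : ℝ≥0∞) := by
    rw [withDensity_congr_ae hgg]
    exact (Measure.withDensity_rnDeriv_eq _ _ hac).symm
  refine ⟨fun x y => g (x - y), by fun_prop, fun a x y => by rw [add_sub_add_right_eq_sub],
    fun f hf => ?_⟩
  have hm : Measurable fun w : Space d => ∫⁻ a, f (w + a, a) :=
    Measurable.lintegral_prod_right' (f := fun z : Space d × Space d => f (z.1 + z.2, z.2))
      (by fun_prop)
  change ∫⁻ γ, pairSum f γ ∂P = _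
  rw [← lintegral_pairMeasure P hf, hinv.lintegral_pairMeasure_eq hf, hdens,
    lintegral_withDensity_eq_lintegral_mul (volume : Measure (Space d)) hg.coe_nnreal_ennreal hm,
    lintegral_mul_comp_sub (g := fun w => (g w : ℝ≥0∞)) hg.coe_nnreal_ennreal hf]
  rfl

/-! ### Extended real arithmetic -/

lemma coe_sub_add_coe_sub (A a : ℝ≥0∞) {B b : ℝ≥0∞} (hB : B ≠ ⊤) (hb : b ≠ ⊤) :
    ((A : EReal) - B) + ((a : EReal) - b) = ((A + a : ℝ≥0∞) : EReal) - ((B + b : ℝ≥0∞) : EReal) := by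
  lift B to ℝ≥0 using hB
  lift b to ℝ≥0 using hb
  induction A with
  | top =>
    induction a with
    | top => rfl
    | coe a => rfl
  | coe A =>
    induction a with
    | top => rfl
    | coe a =>
      change (((A : ℝ) - (B : ℝ) : ℝ) : EReal) + (((a : ℝ) - (b : ℝ) : ℝ) : EReal)
        = ((((A + a : ℝ≥0) : ℝ) - ((B + b : ℝ≥0) : ℝ) : ℝ) : EReal)
      rw [← EReal.coe_add]
      rw [EReal.coe_eq_coe_iff]
      push_cast
      ring

lemma coe_mul_coe_sub (r : ℝ≥0) (a : ℝ≥0∞) {b : ℝ≥0∞} (hb : b ≠ ⊤) :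
    ((r : ℝ) : EReal) * ((a : EReal) - b)
      = ((r * a : ℝ≥0∞) : EReal) - ((r * b : ℝ≥0∞) : EReal) := by
  lift b to ℝ≥0 using hb
  induction a with
  | top =>
    have h1 : ((⊤ : ℝ≥0∞) : EReal) - ((b : ℝ≥0∞) : EReal) = ⊤ := rfl
    rw [h1]
    rcases eq_or_ne r 0 with rfl | hr
    · simp
    · rw [EReal.coe_mul_top_of_pos (by positivity), ENNReal.mul_top (by simpa using hr)]
      rfl
  | coe a =>
    rw [← ENNReal.coe_mul, ← ENNReal.coe_mul]
    change ((r : ℝ) : EReal) * (((a : ℝ) - (b : ℝ) : ℝ) : EReal)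
        = ((((r * a : ℝ≥0) : ℝ) - ((r * b : ℝ≥0) : ℝ) : ℝ) : EReal)
    rw [← EReal.coe_mul]
    rw [EReal.coe_eq_coe_iff]
    push_cast
    ring

lemma coe_toENNReal_sub (x : EReal) :
    (x.toENNReal : EReal) - ((-x).toENNReal : EReal) = x := by
  rcases le_total 0 x with h | h
  · rw [EReal.coe_toENNReal h, EReal.toENNReal_of_nonpos (by simpa using h)]
    simp
  · rw [EReal.coe_toENNReal (x := -x) (by simpa using h), EReal.toENNReal_of_nonpos h]
    simp

lemma toENNReal_neg_ne_top {x : EReal} (hx : x ≠ ⊥) : (-x).toENNReal ≠ ⊤ := by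
  rw [Ne, EReal.toENNReal_eq_top_iff, EReal.neg_eq_top_iff]
  exact hx

lemma sum_eq_coe_sum_sub {ι : Type*} (s : Finset ι) (f : ι → EReal) (hf : ∀ i, f i ≠ ⊥) :
    ∑ i ∈ s, f i = ((∑ i ∈ s, (f i).toENNReal : ℝ≥0∞) : EReal)
      - ((∑ i ∈ s, (-f i).toENNReal : ℝ≥0∞) : EReal) := by
  classical
  induction s using Finset.induction_on with
  | empty => simp
  | insert a s ha ih =>
    rw [Finset.sum_insert ha, Finset.sum_insert ha, Finset.sum_insert ha, ih,
      ← coe_sub_add_coe_sub _ _ (toENNReal_neg_ne_top (hf a))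
        (ENNReal.sum_ne_top.2 fun i _ => toENNReal_neg_ne_top (hf i)), coe_toENNReal_sub]

lemma toENNReal_coe_sub (a b : ℝ≥0∞) : ((a : EReal) - b).toENNReal = a - b := by
  rw [EReal.toENNReal_sub (by positivity)]
  simp

lemma toENNReal_neg_coe_sub (a : ℝ≥0∞) {b : ℝ≥0∞} (hb : b ≠ ⊤) :
    (-((a : EReal) - b)).toENNReal = b - a := by
  rw [EReal.neg_sub (Or.inl (EReal.coe_ennreal_ne_bot _))
    (Or.inr (by simpa using hb)), ← toENNReal_coe_sub, add_comm, sub_eq_add_neg]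

/-- Differences with finite subtrahends are compared by cross-addition, which remains valid when the
minuends are infinite. -/
lemma coe_sub_coe_eq_of_add_eq {a b p q : ℝ≥0∞} (hb : b ≠ ⊤) (hq : q ≠ ⊤) (h : p + b = a + q) :
    (p : EReal) - q = (a : EReal) - b := by
  lift b to ℝ≥0 using hb
  lift q to ℝ≥0 using hq
  induction a with
  | top =>
    have : p = ⊤ := by simpa using h
    subst this
    rfl
  | coe a =>
    have hp : p ≠ ⊤ := by
      rintro rfl
      rw [top_add, ← ENNReal.coe_add] at h
      exact ENNReal.coe_ne_top h.symm
    lift p to ℝ≥0 using hp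
    have h' : (p : ℝ) + b = a + q := by exact_mod_cast h
    change (((p : ℝ) - (q : ℝ) : ℝ) : EReal) = (((a : ℝ) - (b : ℝ) : ℝ) : EReal)
    congr 1
    linarith

/-! ### Integrals of differences of nonnegative functions -/

section Integral

variable {Ω : Type*} [MeasurableSpace Ω] {m : Measure Ω} {a b : Ω → ℝ≥0∞}

lemma hasIntegral_coe_sub (ha : Measurable a) (hb : Measurable b) (hbt : ∀ ω, b ω ≠ ⊤)
    (hbi : ∫⁻ ω, b ω ∂m ≠ ⊤) : HasIntegral m fun ω => (a ω : EReal) - b ω := by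
  refine ⟨?_, ?_⟩
  · simp_rw [sub_eq_add_neg]
    exact (ha.coe_ereal_ennreal.add (continuous_neg.measurable.comp hb.coe_ereal_ennreal)).aemeasurable
  · simp_rw [toENNReal_neg_coe_sub _ (hbt _)]
    exact (lintegral_mono fun ω => tsub_le_self).trans_lt hbi.lt_top

/-- The functions `a` and `b` may overlap and need not be the positive and negative parts. The two
decompositions agree because `(a - b) + b = max a b = a + (b - a)` for truncated subtraction. -/
lemma integralE_coe_sub (ha : Measurable a) (hb : Measurable b) (hbt : ∀ ω, b ω ≠ ⊤)
    (hbi : ∫⁻ ω, b ω ∂m ≠ ⊤) : integralE m (fun ω => (a ω : EReal) - b ω)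
      = ((∫⁻ ω, a ω ∂m : ℝ≥0∞) : EReal) - ((∫⁻ ω, b ω ∂m : ℝ≥0∞) : EReal) := by
  unfold integralE
  simp_rw [toENNReal_neg_coe_sub _ (hbt _), toENNReal_coe_sub]
  refine coe_sub_coe_eq_of_add_eq hbi
    (ne_top_of_le_ne_top hbi (lintegral_mono fun ω => tsub_le_self)) ?_
  rw [← lintegral_add_right _ hb, ← lintegral_add_left ha]
  refine lintegral_congr fun ω => ?_
  rw [tsub_add_eq_max, add_tsub_eq_max]

end Integral

/-! ### The energy in a box -/

/-- The function `F (x - y)`, restricted to pairs of points of a box. -/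
noncomputable def boxPairFun (l : ℝ) (F : Space d → ℝ≥0∞) (p : Space d × Space d) : ℝ≥0∞ :=
  (box d l).indicator 1 p.1 * (box d l).indicator 1 p.2 * F (p.1 - p.2)

lemma measurable_indicator_box (l : ℝ) :
    Measurable ((box d l).indicator (1 : Space d → ℝ≥0∞)) :=
  measurable_one.indicator (measurableSet_box l)

lemma measurable_boxPairFun (l : ℝ) {F : Space d → ℝ≥0∞} (hF : Measurable F) :
    Measurable (boxPairFun l F) := by
  have := measurable_indicator_box (d := d) l
  unfold boxPairFun
  fun_prop

open Classical in
lemma pairSum_boxPairFun (l : ℝ) (F : Space d → ℝ≥0∞) (γ : Configuration d) :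
    pairSum (boxPairFun l F) γ =
      ∑ p ∈ (γ.locallyFinite (box d l) (isBounded_box d l)).toFinset.offDiag, F (p.1 - p.2) := by
  rw [← Finset.tsum_subtype' _ fun p : Space d × Space d => F (p.1 - p.2),
    tsum_subtype _ fun p : Space d × Space d => F (p.1 - p.2)]
  change ∑' p : ({p : Space d × Space d |
      p.1 ∈ γ.carrier ∧ p.2 ∈ γ.carrier ∧ p.1 ≠ p.2} : Set _), boxPairFun l F p = _
  rw [tsum_subtype _ (boxPairFun l F)]
  refine tsum_congr fun p => ?_
  simp only [indicator, boxPairFun, Finset.mem_coe, Finset.mem_offDiag, Finite.mem_toFinset,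
    mem_inter_iff, mem_ofPred_eq, Pi.one_apply]
  by_cases h1 : p.1 ∈ γ.carrier <;> by_cases h2 : p.2 ∈ γ.carrier <;>
    by_cases h3 : p.1 ∈ box d l <;> by_cases h4 : p.2 ∈ box d l <;> simp [h1, h2, h3, h4]

lemma boxEnergy_eq {u : Space d → EReal} (hu : ∀ x, u x ≠ ⊥) (l : ℝ) (γ : Configuration d) :
    boxEnergy u l γ =
      (((1 / 2 : ℝ≥0) * pairSum (boxPairFun l fun w => (u w).toENNReal) γ : ℝ≥0∞) : EReal) -
      (((1 / 2 : ℝ≥0) * pairSum (boxPairFun l fun w => (-u w).toENNReal) γ : ℝ≥0∞) : EReal) := by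
  rw [← coe_mul_coe_sub, pairSum_boxPairFun, pairSum_boxPairFun, boxEnergy,
    sum_eq_coe_sum_sub _ _ fun p => hu _]
  · norm_num
  · rw [pairSum_boxPairFun]
    exact ENNReal.sum_ne_top.2 fun i _ => toENNReal_neg_ne_top (hu _)

/-- The proportion of the points `a` of the box for which `w + a` is in the box. -/
noncomputable def overlap (l : ℝ) (w : Space d) : ℝ≥0∞ :=
  (∫⁻ a, (box d l).indicator 1 (w + a) * (box d l).indicator 1 a) * (volume (box d l))⁻¹

lemma measurable_overlap (l : ℝ) : Measurable (overlap l : Space d → ℝ≥0∞) := by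
  have := measurable_indicator_box (d := d) l
  exact (Measurable.lintegral_prod_right' (f := fun z : Space d × Space d =>
    (box d l).indicator 1 (z.1 + z.2) * (box d l).indicator (1 : Space d → ℝ≥0∞) z.2)
      (by fun_prop)).mul_const _

lemma overlap_le_one (l : ℝ) (w : Space d) : overlap l w ≤ 1 := by
  unfold overlap
  refine (mul_le_mul_left ?_ _).trans (ENNReal.mul_inv_le_one (volume (box d l)))
  rw [← lintegral_indicator_one (measurableSet_box l)]
  refine lintegral_mono fun a => mul_le_of_le_one_left zero_le ?_
  exact indicator_le_self' (fun _ _ => zero_le) _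

/-- The concentric box of half-side `l - ‖w‖` stays inside the large box after translation by `w`.
-/
lemma le_overlap {l : ℝ} {w : Space d} (hl : ‖w‖ < l) :
    ENNReal.ofReal (((l - ‖w‖) / l) ^ d) ≤ overlap l w := by
  have hl0 : 0 < l := (norm_nonneg w).trans_lt hl
  have h1 : volume (box d (l - ‖w‖))
      ≤ ∫⁻ a, (box d l).indicator 1 (w + a) * (box d l).indicator (1 : Space d → ℝ≥0∞) a := by
    rw [← lintegral_indicator_one (measurableSet_box _)]
    refine lintegral_mono fun a => ?_
    by_cases ha : a ∈ box d (l - ‖w‖)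
    · have h2 : a ∈ box d l := fun i => (ha i).trans (by linarith [norm_nonneg w])
      have h3 : w + a ∈ box d l := fun i => by
        have h4 := PiLp.norm_apply_le w i
        rw [Real.norm_eq_abs] at h4
        rw [PiLp.add_apply]
        exact (abs_add_le _ _).trans (by linarith [ha i])
      simp [ha, h2, h3]
    · simp [ha]
  unfold overlap
  refine le_trans ?_ (mul_le_mul_left h1 _)
  rw [volume_box (by linarith), volume_box hl0.le, ← ENNReal.ofReal_inv_of_pos (by positivity),
    ← ENNReal.ofReal_mul (by have : 0 ≤ l - ‖w‖ := by linarith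
                             positivity)]
  refine ENNReal.ofReal_le_ofReal (le_of_eq ?_)
  rw [← inv_pow, ← mul_pow]
  congr 1
  field_simp

lemma tendsto_overlap (w : Space d) : Tendsto (fun l : ℝ => overlap l w) atTop (𝓝 1) := by
  have h1 : Tendsto (fun l : ℝ => ENNReal.ofReal (((l - ‖w‖) / l) ^ d)) atTop (𝓝 1) := by
    rw [← ENNReal.ofReal_one, ← one_pow d]
    refine ENNReal.tendsto_ofReal (Tendsto.pow ?_ d)
    have h2 : Tendsto (fun l : ℝ => 1 - ‖w‖ / l) atTop (𝓝 (1 - 0)) :=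
      tendsto_const_nhds.sub (tendsto_const_nhds.div_atTop tendsto_id)
    rw [sub_zero] at h2
    refine h2.congr' ?_
    filter_upwards [eventually_gt_atTop 0] with l hl
    field_simp
  refine tendsto_of_tendsto_of_tendsto_of_le_of_le' h1 tendsto_const_nhds ?_
    (Eventually.of_forall fun l => overlap_le_one l w)
  filter_upwards [eventually_gt_atTop ‖w‖] with l hl using le_overlap hl

/-- `F` need not be integrable, so dominated convergence is unavailable. Fatou gives the lower bound
and `overlap ≤ 1` the upper one. -/
lemma tendsto_lintegral_mul_overlap {F : Space d → ℝ≥0∞} (hF : Measurable F) :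
    Tendsto (fun l : ℝ => ∫⁻ w, F w * overlap l w) atTop (𝓝 (∫⁻ w, F w)) := by
  refine tendsto_of_le_liminf_of_limsup_le ?_ ?_
  · refine le_trans (le_of_eq ?_) (lintegral_liminf_le fun l => hF.mul (measurable_overlap l))
    refine lintegral_congr fun w => ?_
    have h := ENNReal.Tendsto.const_mul (a := F w) (tendsto_overlap w) (Or.inl one_ne_zero)
    rw [mul_one] at h
    exact h.liminf_eq.symm
  · refine limsup_le_of_le (by isBoundedDefault) (Eventually.of_forall fun l => ?_)
    exact lintegral_mono fun w => mul_le_of_le_one_right zero_le (overlap_le_one l w)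

/-! ### The specific energy -/

namespace IsPairCorrelation

variable {P : Measure (Configuration d)} {ρ : Space d → Space d → ℝ≥0}

lemma measurable_zero (hρ : IsPairCorrelation P ρ) : Measurable fun w => ρ w 0 :=
  hρ.measurable.comp (measurable_id.prodMk measurable_const)

lemma lintegral_pairSum (hρ : IsPairCorrelation P ρ) {f : Space d × Space d → ℝ≥0∞}
    (hf : Measurable f) :
    ∫⁻ γ, pairSum f γ ∂P = ∫⁻ w, (ρ w 0 : ℝ≥0∞) * ∫⁻ a, f (w + a, a) := by
  have h : ∀ x y, ρ x y = ρ (x - y) 0 := by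
    intro x y
    rw [← hρ.translation y (x - y) 0, sub_add_cancel, zero_add]
  rw [← lintegral_mul_comp_sub (g := fun w => (ρ w 0 : ℝ≥0∞))
    hρ.measurable_zero.coe_nnreal_ennreal hf]
  refine (hρ.density f hf).trans (lintegral_congr fun p => ?_)
  rw [h p.1 p.2]

lemma lintegral_pairSum_boxPairFun (hρ : IsPairCorrelation P ρ) {l : ℝ} (hl : 0 < l)
    {F : Space d → ℝ≥0∞} (hF : Measurable F) :
    ∫⁻ γ, pairSum (boxPairFun l F) γ ∂P
      = volume (box d l) * ∫⁻ w, F w * ρ w 0 * overlap l w := by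
  have hvol : volume (box d l) ≠ 0 := by
    rw [volume_box hl.le]
    have : 0 < (2 * l) ^ d := by positivity
    simpa using this
  have hvol' : volume (box d l) ≠ ⊤ := by
    rw [volume_box hl.le]; exact ENNReal.ofReal_ne_top
  have := measurable_indicator_box (d := d) l
  have hm : Measurable fun w => F w * ρ w 0 * overlap l w :=
    (hF.mul hρ.measurable_zero.coe_nnreal_ennreal).mul (measurable_overlap l)
  rw [hρ.lintegral_pairSum (measurable_boxPairFun l hF), ← lintegral_const_mul _ hm]
  refine lintegral_congr fun w => ?_
  simp only [boxPairFun, add_sub_cancel_right, overlap]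
  rw [lintegral_mul_const _ (by fun_prop)]
  set I := ∫⁻ a, (box d l).indicator 1 (w + a) * (box d l).indicator (1 : Space d → ℝ≥0∞) a
  calc (ρ w 0 : ℝ≥0∞) * (I * F w)
      = F w * ρ w 0 * I * (volume (box d l) * (volume (box d l))⁻¹) := by
        rw [ENNReal.mul_inv_cancel hvol hvol']; ring
    _ = _ := by ring

/-- Averaging over the position of `y` in a cube of volume 1 identifies the integral with an
expected pair sum, which lower regularity bounds by second moments of cube counts. -/
lemma lintegral_negPart_ne_top (hd : 0 < d) (hP : IsInvariantGibbs P)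
    (hρ : IsPairCorrelation P ρ) {u : Space d → EReal} (hu : IsPairPotential u) :
    ∫⁻ w, (-u w).toENNReal * ρ w 0 ≠ ⊤ := by
  obtain ⟨c, hcs, hc⟩ := hu.exists_lower_bound hd
  have hum : Measurable fun w => (-u w).toENNReal :=
    (continuous_neg.measurable.comp hu.measurable).ereal_toENNReal
  set f : Space d × Space d → ℝ≥0∞ := fun p =>
    (unitCube 0).indicator 1 p.2 * (-u (p.1 - p.2)).toENNReal
  have hq : Measurable ((unitCube 0).indicator (1 : Space d → ℝ≥0∞)) :=
    measurable_one.indicator (measurableSet_unitCube 0)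
  have hf : Measurable f :=
    (hq.comp measurable_snd).mul (hum.comp (measurable_fst.sub measurable_snd))
  have h1 : ∫⁻ γ, pairSum f γ ∂P = ∫⁻ w, (-u w).toENNReal * ρ w 0 := by
    rw [hρ.lintegral_pairSum hf]
    refine lintegral_congr fun w => ?_
    simp only [f, add_sub_cancel_right]
    rw [lintegral_mul_const _ hq, lintegral_indicator_one (measurableSet_unitCube 0),
      volume_unitCube, one_mul, mul_comm]
  rw [← h1, ← lintegral_pairMeasure P hf]
  refine ne_top_of_le_ne_top (hP.lintegral_cubeCount_mul_ne_top hd hcs)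
    (lintegral_pairMeasure_le P hf _ ?_)
  rintro ⟨x, y⟩ hxy
  by_cases hy : y ∈ unitCube 0
  · refine mul_le_mul_right ?_ _
    have h2 := hc _ y hy x (mem_unitCube_iff.2 rfl) (Ne.symm hxy)
    -- The cell bound has the point of the central cube first. Evenness exchanges the roles.
    rw [← hu.even, neg_sub] at h2
    have h3 : -u (x - y) ≤ ((c (cubeIndex x) : ℝ) : EReal) := by
      rw [EReal.neg_le, ← EReal.coe_neg]
      exact h2
    refine (EReal.toENNReal_le_toENNReal h3).trans ?_
    simp
  · simp [f, hy]

/-- The specific energy of an invariant Gibbs measure in terms of its pair correlation function. -/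
theorem hasSpecificEnergy (hd : 0 < d) (hP : IsInvariantGibbs P)
    (hρ : IsPairCorrelation P ρ) {u : Space d → EReal} (hu : IsPairPotential u) :
    HasIntegral volume (fun x => u x * (((ρ x 0 : ℝ≥0) : ℝ) : EReal)) ∧
      HasSpecificEnergy u P (((1 / 2 : ℝ) : EReal) *
        integralE volume (fun x => u x * (((ρ x 0 : ℝ≥0) : ℝ) : EReal))) := by
  set p : Space d → ℝ≥0∞ := fun w => (u w).toENNReal
  set n : Space d → ℝ≥0∞ := fun w => (-u w).toENNReal
  have hp : Measurable p := hu.measurable.ereal_toENNReal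
  have hn : Measurable n := (continuous_neg.measurable.comp hu.measurable).ereal_toENNReal
  have hg : Measurable fun w => (ρ w 0 : ℝ≥0∞) := hρ.measurable_zero.coe_nnreal_ennreal
  have hneg : ∫⁻ w, n w * ρ w 0 ≠ ⊤ := lintegral_negPart_ne_top hd hP hρ hu
  have hfun : (fun x => u x * (((ρ x 0 : ℝ≥0) : ℝ) : EReal))
      = fun x => ((p x * ρ x 0 : ℝ≥0∞) : EReal) - ((n x * ρ x 0 : ℝ≥0∞) : EReal) := by
    funext x
    rw [mul_comm (u x), mul_comm (p x), mul_comm (n x),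
      ← coe_mul_coe_sub _ _ (toENNReal_neg_ne_top (hu.ne_bot x)), coe_toENNReal_sub]
  have hnt : ∀ x, n x * ρ x 0 ≠ ⊤ := fun x =>
    ENNReal.mul_ne_top (toENNReal_neg_ne_top (hu.ne_bot x)) ENNReal.coe_ne_top
  have hpg : Measurable fun w => p w * ρ w 0 := hp.mul hg
  have hng : Measurable fun w => n w * ρ w 0 := hn.mul hg
  rw [hfun, integralE_coe_sub hpg hng hnt hneg]
  refine ⟨hasIntegral_coe_sub hpg hng hnt hneg, ?_⟩
  have hhalf : ((1 / 2 : ℝ) : EReal) = (((1 / 2 : ℝ≥0) : ℝ) : EReal) := by norm_num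
  rw [hhalf, coe_mul_coe_sub _ _ hneg]
  have hmean : ∀ F : Space d → ℝ≥0∞, Measurable F → ∀ l : ℝ, 0 < l →
      ∫⁻ γ, ((1 / 2 : ℝ≥0) : ℝ≥0∞) * pairSum (boxPairFun l F) γ ∂P =
        ((1 / 2 : ℝ≥0) : ℝ≥0∞) * (volume (box d l) * ∫⁻ w, F w * ρ w 0 * overlap l w) := by
    intro F hF l hl
    rw [lintegral_const_mul _ (measurable_pairSum (measurable_boxPairFun l hF)),
      hρ.lintegral_pairSum_boxPairFun hl hF]
  have hvol : ∀ l : ℝ, 0 < l → volume (box d l) ≠ 0 ∧ volume (box d l) ≠ ⊤ := by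
    intro l hl
    rw [volume_box hl.le]
    have : 0 < (2 * l) ^ d := by positivity
    exact ⟨by simpa using this, ENNReal.ofReal_ne_top⟩
  have hnl : ∀ l : ℝ, ∫⁻ w, n w * ρ w 0 * overlap l w ≠ ⊤ := fun l =>
    ne_top_of_le_ne_top hneg
      (lintegral_mono fun w => mul_le_of_le_one_right zero_le (overlap_le_one l w))
  have hmp : ∀ (F : Space d → ℝ≥0∞) (l : ℝ), Measurable F →
      Measurable fun γ => ((1 / 2 : ℝ≥0) : ℝ≥0∞) * pairSum (boxPairFun l F) γ := fun F l hF =>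
    (measurable_pairSum (measurable_boxPairFun l hF)).const_mul _
  have hpt : ∀ (l : ℝ) (γ : Configuration d),
      ((1 / 2 : ℝ≥0) : ℝ≥0∞) * pairSum (boxPairFun l n) γ ≠ ⊤ := by
    intro l γ
    rw [pairSum_boxPairFun]
    exact ENNReal.mul_ne_top ENNReal.coe_ne_top
      (ENNReal.sum_ne_top.2 fun i _ => toENNReal_neg_ne_top (hu.ne_bot _))
  have hfin : ∀ l : ℝ, 0 < l →
      ∫⁻ γ, ((1 / 2 : ℝ≥0) : ℝ≥0∞) * pairSum (boxPairFun l n) γ ∂P ≠ ⊤ := by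
    intro l hl
    rw [hmean n hn l hl]
    exact ENNReal.mul_ne_top ENNReal.coe_ne_top (ENNReal.mul_ne_top (hvol l hl).2 (hnl l))
  have henergy : ∀ l, boxEnergy u l = fun γ =>
      (((1 / 2 : ℝ≥0) * pairSum (boxPairFun l p) γ : ℝ≥0∞) : EReal) -
      (((1 / 2 : ℝ≥0) * pairSum (boxPairFun l n) γ : ℝ≥0∞) : EReal) := fun l =>
    funext fun γ => boxEnergy_eq hu.ne_bot l γ
  have hhalf_neg : ((1 / 2 : ℝ≥0) : ℝ≥0∞) * ∫⁻ w, n w * ρ w 0 ≠ ⊤ :=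
    ENNReal.mul_ne_top ENNReal.coe_ne_top hneg
  have hneg_ne : -(((1 / 2 : ℝ≥0) * ∫⁻ w, n w * ρ w 0 : ℝ≥0∞) : EReal) ≠ ⊥ := by
    rw [Ne, EReal.neg_eq_bot_iff, EReal.coe_ennreal_eq_top_iff]
    exact hhalf_neg
  refine ⟨?_, ?_, ?_⟩
  · rw [sub_eq_add_neg, Ne, EReal.add_eq_bot_iff, not_or]
    exact ⟨EReal.coe_ennreal_ne_bot _, hneg_ne⟩
  · intro l hl
    rw [henergy]
    exact hasIntegral_coe_sub (hmp p l hp) (hmp n l hn) (hpt l) (hfin l hl)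
  · have hlim : ∀ F : Space d → ℝ≥0∞, Measurable F → Tendsto (fun l : ℝ =>
        (((1 / 2 : ℝ≥0) * ∫⁻ w, F w * ρ w 0 * overlap l w : ℝ≥0∞) : EReal)) atTop
        (𝓝 (((1 / 2 : ℝ≥0) * ∫⁻ w, F w * ρ w 0 : ℝ≥0∞) : EReal)) := by
      intro F hF
      exact (continuous_coe_ennreal_ereal.tendsto _).comp
        (ENNReal.Tendsto.const_mul (tendsto_lintegral_mul_overlap (hF.mul hg))
          (Or.inr ENNReal.coe_ne_top))
    -- Addition of extended reals is continuous here because the limit of the negative part is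
    -- finite, even if the positive part diverges.
    have htend := (EReal.continuousAt_add (Or.inr hneg_ne)
      (Or.inl (EReal.coe_ennreal_ne_bot _))).tendsto.comp
        ((hlim p hp).prodMk_nhds (continuous_neg.tendsto _ |>.comp (hlim n hn)))
    rw [sub_eq_add_neg]
    refine htend.congr' ?_
    filter_upwards [eventually_gt_atTop 0] with l hl
    rw [meanEnergy, henergy, integralE_coe_sub (hmp p l hp) (hmp n l hn) (hpt l) (hfin l hl),
      hmean p hp l hl, hmean n hn l hl]
    have hr : ((volume (box d l)).toReal⁻¹ : ℝ)
        = (((volume (box d l)).toNNReal⁻¹ : ℝ≥0) : ℝ) := by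
      rw [NNReal.coe_inv]; rfl
    have hinv : (((volume (box d l)).toNNReal⁻¹ : ℝ≥0) : ℝ≥0∞) = (volume (box d l))⁻¹ := by
      rw [ENNReal.coe_inv ((ENNReal.toNNReal_ne_zero).2 (hvol l hl)),
        ENNReal.coe_toNNReal (hvol l hl).2]
    have hcancel : ∀ I : ℝ≥0∞, (volume (box d l))⁻¹ *
        (((1 / 2 : ℝ≥0) : ℝ≥0∞) * (volume (box d l) * I)) = ((1 / 2 : ℝ≥0) : ℝ≥0∞) * I := by
      intro I
      rw [mul_left_comm, ← mul_assoc (volume (box d l))⁻¹,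
        ENNReal.inv_mul_cancel (hvol l hl).1 (hvol l hl).2, one_mul]
    rw [hr, coe_mul_coe_sub _ _ (ENNReal.mul_ne_top ENNReal.coe_ne_top
      (ENNReal.mul_ne_top (hvol l hl).2 (hnl l))), hinv, hcancel, hcancel]
    rfl

end IsPairCorrelation

end PairGas

theorem mainTheorem3 {d : ℕ} (hd : 0 < d)
    (u : PairGas.Space d → EReal) (hu : PairGas.IsPairPotential u)
    (P : Measure (PairGas.Configuration d)) (hP : PairGas.IsInvariantGibbs P) :
    (∃ ρ : PairGas.Space d → PairGas.Space d → ℝ≥0, PairGas.IsPairCorrelation P ρ) ∧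
    ∀ ρ : PairGas.Space d → PairGas.Space d → ℝ≥0, PairGas.IsPairCorrelation P ρ →
      PairGas.HasIntegral volume (fun x => u x * (((ρ x 0 : ℝ≥0) : ℝ) : EReal)) ∧
      PairGas.HasSpecificEnergy u P
        (((1 / 2 : ℝ) : EReal) *
          PairGas.integralE volume (fun x => u x * (((ρ x 0 : ℝ≥0) : ℝ) : EReal))) :=
  ⟨hP.exists_isPairCorrelation hd, fun _ hρ => hρ.hasSpecificEnergy hd hP hu⟩
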